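/- Let $p\in C^1([0,1];(0,\infty))$, $r\in C^0([0,1];(0,\infty))$, $q\in C^0([0,1];\mathbb R)$ and let $a_1,a_2,b_1,b_2\in\mathbb R$ with $|a_1|+|a_2|>0$, $|b_1|+|b_2|>0$. Write $\|g\|_r=\big(\int_0^1 r(x)|g(x)|^2dx\big)^{1/2}$ and let $L^2_r(0,1)$ be the space of measurable functions on $[0,1]$ with finite $\|\cdot\|_r$. Let $A:D\to L^2_r(0,1)$ be the Sturm–Liouville operator $$(Ag)(x)=-\frac1{r(x)}\frac{d}{dx}\Big(p(x)\frac{dg}{dx}(x)\Big)+\frac{q(x)}{r(x)}g(x),$$ $$D=\{g\in H^2(0,1): b_1g(0)+b_2g'(0)=a_1g(1)+a_2g'(1)=0\}.$$ Let $\lambda_1<\lambda_2<\cdots$ be its eigenvalues and $\phi_n\in C^2([0,1])$, $\|\phi_n\|_r=1$, the corresponding eigenfunctions. Assume (H) $\sum_{n\ge N}\lambda_n^{-1}\max_{0\le x\le1}|\phi_n(x)|<\infty$ for some $N$ with $\lambda_N>0$, and that $A$ is exponentially stable, i.e. $\lambda_1>0$. *Inputs.* Below, $(\tau_i)_{i\ge0}$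 denotes a sequence $0=\tau_0<\tau_1<\cdots$ with $\tau_i\to+\infty$, and $I=[0,\infty)\setminus\{\tau_i : i\ge 0\}$; we write $g[t]=g(t,\cdot)$. A continuous $g:[0,1]\to\mathbb R$ is in $PC^1([0,1])$ if it has finite one-sided derivatives (from the right on $[0,1)$, from the left on $(0,1]$) and, outside a finite subset of $(0,1)$, is differentiable on $(0,1)$ with continuous derivative. A function $f:[0,\infty)\times[0,1]\to\mathbb R$ is of class GD if there is such a sequence $(\tau_i)$ so that for every $i\ge1$ there are $f_1,f_2\in C^0((\tau_{i-1},\tau_i)\times[0,1])$, $a\in PC^1([0,1])$, $b\in C^0([0,1])$, $c\in D\cap C^2([0,1])$ such that: $f_1[t]\in PC^1([0,1])$, $f_2[t]\in D\cap C^2([0,1])$ and $f[t]=f_1[t]+f_2[t]$ for all $t\in(\tau_{i-1},\tau_i)$; $\sup_{t\in(\tau_{i-1},\tau_i)}\int_0^1 r\,(|f_1[t]|^2+|f_2[t]|^2+|Af_2[t]|^2)\,dx<\infty$; $\partial_tf_1$ exists and is continuous on $(\tau_{i-1},\tau_i)\times[0,1]$; and, as $t\to\tau_i^-$, $f_1(t,x)\to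 a(x)$, $\partial_tf_1(t,x)\to b(x)$, $f_2(t,x)\to c(x)$ for every $x\in[0,1]$. A right continuous $d:[0,\infty)\to\mathbb R$ is of class GB if there is such a sequence $(\tau_i)$ with $d\in C^2(I)$, with finite left limits of $d,\dot d,\ddot d$ at each $\tau_i>0$, and with $\sup_{(\tau_i,\tau_{i+1})}|\dot d|<\infty$ for each $i\ge0$. *Solutions.* Let $u_0\in L^2_r(0,1)$, $f\in GD$, $d_0,d_1\in GB$. A solution is a mapping $u\in C^0([0,\infty);L^2_r(0,1))$ for which, with a sequence $(\tau_i)$ that serves for $f$, $d_0$ and $d_1$ in the definitions above: $u\in C^1(I\times[0,1])$; $u[t]\in C^2([0,1])$ for all $t>0$; for all $i\ge1$ and $x\in[0,1]$, as $t\to\tau_i^-$, $u(t,x)\to u(\tau_i,x)$, $\partial_xu(t,x)\to\partial_xu(\tau_i,x)$ and $\partial_tu(t,x)\to-(Au[\tau_i])(x)+\lim_{t\to\tau_i^-}f(t,x)$; $u(0,x)=u_0(x)$ for $x\in[0,1]$; $\partial_tu(t,x)+(Au[t])(x)=f(t,x)$ for $(t,x)\in I\times(0,1)$; and $b_1u(t,0)+b_2\partial_xu(t,0)=d_0(t)$,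 $a_1u(t,1)+a_2\partial_xu(t,1)=d_1(t)$ for $t\in I$. (Here $Ag$ is given by the differential expression above for every $g\in C^2([0,1])$.) **Theorem.** (a) The boundary value problem $(pv')'-qv=0$ on $[0,1]$ has exactly one solution $v=\tilde u\in C^2([0,1])$ with $b_1v(0)+b_2v'(0)=\sqrt{b_1^2+b_2^2}$, $a_1v(1)+a_2v'(1)=0$, and exactly one solution $v=\bar u\in C^2([0,1])$ with $b_1v(0)+b_2v'(0)=0$, $a_1v(1)+a_2v'(1)=\sqrt{a_1^2+a_2^2}$. The following series converge and the stated equalities hold: $$C_0:=\frac{p(0)}{b_1^2+b_2^2}\sqrt{\sum_{n=1}^\infty\frac1{\lambda_n^2}\big|b_1\phi_n'(0)-b_2\phi_n(0)\big|^2}=\frac{\|\tilde u\|_r}{\sqrt{b_1^2+b_2^2}},$$ $$C_1:=\frac{p(1)}{a_1^2+a_2^2}\sqrt{\sum_{n=1}^\infty\frac1{\lambda_n^2}\big|a_2\phi_n(1)-a_1\phi_n'(1)\big|^2}=\frac{\|\bar u\|_r}{\sqrt{a_1^2+a_2^2}}.$$ (b) For all $u_0\in L^2_r(0,1)$, $f\in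 GD$, $d_0,d_1\in GB$, every solution $u$ with initial condition $u_0$ and inputs $f,d_0,d_1$ satisfies, for all $\sigma\in[0,\lambda_1)$ and $t>0$, $$\begin{aligned}\|u[t]\|_r\le{}& e^{-\lambda_1t}\|u_0\|_r+\frac{\lambda_1}{\lambda_1-\sigma}C_0\sup_{0<s<t}\big(|d_0(s)|e^{-\sigma(t-s)}\big)+\frac{\lambda_1}{\lambda_1-\sigma}C_1\sup_{0<s<t}\big(|d_1(s)|e^{-\sigma(t-s)}\big)\\&+\frac1{\lambda_1-\sigma}\sup_{0<s<t}\big(\|f[s]\|_re^{-\sigma(t-s)}\big),\end{aligned}$$ where the suprema are finite; if $f[s]\notin L^2_r(0,1)$ at some of the exceptional times $s=\tau_i$, these times may be left out of the last supremum. -/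

import Mathlib

open Set Filter Topology MeasureTheory

noncomputable section

/-- The data of a regular Sturm-Liouville problem on `[0,1]`: coefficients
`p ∈ C¹([0,1];(0,∞))`, `r ∈ C⁰([0,1];(0,∞))`, `q ∈ C⁰([0,1];ℝ)` and real numbers
`a₁, a₂, b₁, b₂` of the boundary conditions. Values outside `[0,1]` are irrelevant. -/
structure SLData where
  p : ℝ → ℝ
  r : ℝ → ℝ
  q : ℝ → ℝ
  a₁ : ℝ
  a₂ : ℝ
  b₁ : ℝ
  b₂ : ℝ
  p_contDiffOn : ContDiffOn ℝ 1 p (Icc 0 1)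
  p_pos : ∀ x ∈ Icc (0 : ℝ) 1, 0 < p x
  r_continuousOn : ContinuousOn r (Icc 0 1)
  r_pos : ∀ x ∈ Icc (0 : ℝ) 1, 0 < r x
  q_continuousOn : ContinuousOn q (Icc 0 1)
  a_pos : 0 < |a₁| + |a₂|
  b_pos : 0 < |b₁| + |b₂|

/-- The spatial derivative on `[0,1]` (one-sided at the end points). -/
def dx (g : ℝ → ℝ) (x : ℝ) : ℝ := derivWithin g (Icc 0 1) x

/-- Membership in the Sobolev space `H²(0,1)`: `g` is continuously differentiable on `[0,1]` and
`g'` is the integral of a square-integrable function. -/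
def InH2 (g : ℝ → ℝ) : Prop :=
  ContDiffOn ℝ 1 g (Icc 0 1) ∧
  ∃ h : ℝ → ℝ, MemLp h 2 (volume.restrict (Icc 0 1)) ∧
    ∀ x ∈ Icc (0 : ℝ) 1, dx g x = dx g 0 + ∫ y in (0 : ℝ)..x, h y

/-- The class `PC¹([0,1])` of continuous, piecewise `C¹` functions. -/
def PiecewiseC1 (g : ℝ → ℝ) : Prop :=
  ContinuousOn g (Icc 0 1) ∧
  (∀ x ∈ Ico (0 : ℝ) 1, ∃ l, HasDerivWithinAt g l (Ici x) x) ∧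
  (∀ x ∈ Ioc (0 : ℝ) 1, ∃ l, HasDerivWithinAt g l (Iic x) x) ∧
  ∃ F : Finset ℝ, (F : Set ℝ) ⊆ Ioo 0 1 ∧
    (∀ x ∈ Ioo (0 : ℝ) 1 \ F, DifferentiableAt ℝ g x) ∧
    ContinuousOn (deriv g) (Ioo (0 : ℝ) 1 \ F)

/-- An increasing sequence of times `0 = τ₀ < τ₁ < ⋯` tending to `+∞`. -/
structure IsTimeSequence (τ : ℕ → ℝ) : Prop where
  zero : τ 0 = 0
  strictMono : StrictMono τ
  tendsto : Tendsto τ atTop atTop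

/-- `I = [0,∞) \ {τ₀, τ₁, …}`. -/
def regularTimes (τ : ℕ → ℝ) : Set ℝ := Ici 0 \ range τ

/-- Assumption (H) for the eigenvalues `lam` and eigenfunctions `φ`:
`∑_{n ≥ N} λₙ⁻¹ max_{0≤x≤1} |φₙ(x)| < ∞` for some `N` with `λ_N > 0`. -/
def AssumptionH (lam : ℕ → ℝ) (φ : ℕ → ℝ → ℝ) : Prop :=
  ∃ N : ℕ, 0 < lam N ∧
    Summable fun n : ℕ => (lam (N + n))⁻¹ * ⨆ x : Icc (0 : ℝ) 1, |φ (N + n) x|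

namespace SLData

variable (S : SLData)

/-- `g ∈ L²_r(0,1)`. -/
def MemL2 (g : ℝ → ℝ) : Prop :=
  AEStronglyMeasurable g (volume.restrict (Ioc 0 1)) ∧
  IntervalIntegrable (fun x => S.r x * g x ^ 2) volume 0 1

/-- The norm `‖g‖_r = (∫₀¹ r(x) |g(x)|² dx)^{1/2}`. -/
def norm (g : ℝ → ℝ) : ℝ := Real.sqrt (∫ x in (0 : ℝ)..1, S.r x * g x ^ 2)

/-- The differential expression
`(A g)(x) = -(1/r(x)) (p(x) g'(x))' + (q(x)/r(x)) g(x)`. -/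
def A (g : ℝ → ℝ) (x : ℝ) : ℝ :=
  -(1 / S.r x) * dx (fun y => S.p y * dx g y) x + S.q x / S.r x * g x

/-- The boundary expression at `x = 0`. -/
def bc0 (g : ℝ → ℝ) : ℝ := S.b₁ * g 0 + S.b₂ * dx g 0

/-- The boundary expression at `x = 1`. -/
def bc1 (g : ℝ → ℝ) : ℝ := S.a₁ * g 1 + S.a₂ * dx g 1

/-- The domain `D ⊆ H²(0,1)` of the operator. -/
def InDomain (g : ℝ → ℝ) : Prop := InH2 g ∧ S.bc0 g = 0 ∧ S.bc1 g = 0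

/-- `μ` is an eigenvalue of `A : D → L²_r(0,1)`. -/
def IsEigenvalue (μ : ℝ) : Prop :=
  ∃ g : ℝ → ℝ, S.InDomain g ∧ (∃ x ∈ Icc (0 : ℝ) 1, g x ≠ 0) ∧
    ∀ᵐ x ∂(volume.restrict (Ioo (0 : ℝ) 1)), S.A g x = μ * g x

/-- `lam 0 < lam 1 < ⋯` are all the eigenvalues of `A`, in increasing order, and `φ n ∈ C²([0,1])`
is a normalized eigenfunction for `lam n` (numbering starts at `0`). -/
structure IsEigensystem (lam : ℕ → ℝ) (φ : ℕ → ℝ → ℝ) : Prop where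
  strictMono : StrictMono lam
  isEigenvalue_iff : ∀ μ, S.IsEigenvalue μ ↔ ∃ n, lam n = μ
  contDiffOn : ∀ n, ContDiffOn ℝ 2 (φ n) (Icc 0 1)
  inDomain : ∀ n, S.InDomain (φ n)
  eigen : ∀ n, ∀ x ∈ Ioo (0 : ℝ) 1, S.A (φ n) x = lam n * φ n x
  normalized : ∀ n, S.norm (φ n) = 1

/-- `f` is of class GD with respect to the sequence of times `τ`. -/
def IsGDWith (τ : ℕ → ℝ) (f : ℝ → ℝ → ℝ) : Prop :=
  ∀ i : ℕ, ∃ (f₁ f₂ : ℝ → ℝ → ℝ) (a b c : ℝ → ℝ),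
    ContinuousOn (Function.uncurry f₁) (Ioo (τ i) (τ (i + 1)) ×ˢ Icc (0 : ℝ) 1) ∧
    ContinuousOn (Function.uncurry f₂) (Ioo (τ i) (τ (i + 1)) ×ˢ Icc (0 : ℝ) 1) ∧
    PiecewiseC1 a ∧ ContinuousOn b (Icc 0 1) ∧
    (S.InDomain c ∧ ContDiffOn ℝ 2 c (Icc 0 1)) ∧
    (∀ t ∈ Ioo (τ i) (τ (i + 1)), PiecewiseC1 (f₁ t) ∧
      (S.InDomain (f₂ t) ∧ ContDiffOn ℝ 2 (f₂ t) (Icc 0 1)) ∧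
      ∀ x ∈ Icc (0 : ℝ) 1, f t x = f₁ t x + f₂ t x) ∧
    (∃ M : ℝ, ∀ t ∈ Ioo (τ i) (τ (i + 1)),
      ∫ x in (0 : ℝ)..1, S.r x * (f₁ t x ^ 2 + f₂ t x ^ 2 + S.A (f₂ t) x ^ 2) ≤ M) ∧
    (∀ t ∈ Ioo (τ i) (τ (i + 1)), ∀ x ∈ Icc (0 : ℝ) 1,
      DifferentiableAt ℝ (fun s => f₁ s x) t) ∧
    ContinuousOn (fun z : ℝ × ℝ => deriv (fun s => f₁ s z.2) z.1)
      (Ioo (τ i) (τ (i + 1)) ×ˢ Icc (0 : ℝ) 1) ∧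
    ∀ x ∈ Icc (0 : ℝ) 1,
      Tendsto (fun t => f₁ t x) (𝓝[<] τ (i + 1)) (𝓝 (a x)) ∧
      Tendsto (fun t => deriv (fun s => f₁ s x) t) (𝓝[<] τ (i + 1)) (𝓝 (b x)) ∧
      Tendsto (fun t => f₂ t x) (𝓝[<] τ (i + 1)) (𝓝 (c x))

/-- The class GD of distributed inputs. -/
def IsGD (f : ℝ → ℝ → ℝ) : Prop := ∃ τ, IsTimeSequence τ ∧ S.IsGDWith τ f

end SLData

/-- `d` is of class GB with respect to the sequence of times `τ`. -/
def IsGBWith (τ : ℕ → ℝ) (d : ℝ → ℝ) : Prop :=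
  (∀ t, 0 ≤ t → ContinuousWithinAt d (Ici t) t) ∧
  ContDiffOn ℝ 2 d (regularTimes τ) ∧
  (∀ i, 0 < τ i →
    (∃ l, Tendsto d (𝓝[<] τ i) (𝓝 l)) ∧
    (∃ l, Tendsto (deriv d) (𝓝[<] τ i) (𝓝 l)) ∧
    (∃ l, Tendsto (deriv (deriv d)) (𝓝[<] τ i) (𝓝 l))) ∧
  ∀ i, ∃ M : ℝ, ∀ t ∈ Ioo (τ i) (τ (i + 1)), |deriv d t| ≤ M

/-- The class GB of boundary inputs. -/
def IsGB (d : ℝ → ℝ) : Prop := ∃ τ, IsTimeSequence τ ∧ IsGBWith τ d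

namespace SLData

variable (S : SLData)

/-- `u` is a solution of the evolution equation
`u_t = (1/r) (p u_x)_x - (q/r) u + f` with boundary conditions
`b₁ u(t,0) + b₂ u_x(t,0) = d₀(t)`, `a₁ u(t,1) + a₂ u_x(t,1) = d₁(t)` and initial condition `u₀`,
regular away from the times `τ`. -/
structure IsSolutionWith (τ : ℕ → ℝ) (u₀ : ℝ → ℝ) (f : ℝ → ℝ → ℝ) (d₀ d₁ : ℝ → ℝ)
    (u : ℝ → ℝ → ℝ) : Prop where
  memL2 : ∀ t, 0 ≤ t → S.MemL2 (u t)
  continuous_L2 : ∀ t, 0 ≤ t →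
    Tendsto (fun s => S.norm (fun x => u s x - u t x)) (𝓝[Ici 0] t) (𝓝 0)
  contDiffOn : ContDiffOn ℝ 1 (Function.uncurry u) (regularTimes τ ×ˢ Icc (0 : ℝ) 1)
  contDiffOn_profile : ∀ t, 0 < t → ContDiffOn ℝ 2 (u t) (Icc 0 1)
  left_limit : ∀ i, 1 ≤ i → ∀ x ∈ Icc (0 : ℝ) 1,
    Tendsto (fun t => u t x) (𝓝[<] τ i) (𝓝 (u (τ i) x))
  left_limit_dt : ∀ i, 1 ≤ i → ∀ x ∈ Icc (0 : ℝ) 1, ∃ l : ℝ,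
    Tendsto (fun t => f t x) (𝓝[<] τ i) (𝓝 l) ∧
    Tendsto (fun t => deriv (fun s => u s x) t) (𝓝[<] τ i) (𝓝 (-S.A (u (τ i)) x + l))
  left_limit_dx : ∀ i, 1 ≤ i → ∀ x ∈ Icc (0 : ℝ) 1,
    Tendsto (fun t => dx (u t) x) (𝓝[<] τ i) (𝓝 (dx (u (τ i)) x))
  initial : ∀ x ∈ Icc (0 : ℝ) 1, u 0 x = u₀ x
  pde : ∀ t ∈ regularTimes τ, ∀ x ∈ Ioo (0 : ℝ) 1,
    deriv (fun s => u s x) t + S.A (u t) x = f t x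
  boundary0 : ∀ t ∈ regularTimes τ, S.bc0 (u t) = d₀ t
  boundary1 : ∀ t ∈ regularTimes τ, S.bc1 (u t) = d₁ t

/-- `u` is a solution of the evolution equation with initial condition `u₀` corresponding to the
inputs `f`, `d₀`, `d₁`; the sequence of times is one that serves for all three inputs. -/
def IsSolution (u₀ : ℝ → ℝ) (f : ℝ → ℝ → ℝ) (d₀ d₁ : ℝ → ℝ) (u : ℝ → ℝ → ℝ) : Prop :=
  ∃ τ, IsTimeSequence τ ∧ S.IsGDWith τ f ∧ IsGBWith τ d₀ ∧ IsGBWith τ d₁ ∧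
    S.IsSolutionWith τ u₀ f d₀ d₁ u

/-- `v ∈ C²([0,1])` solves `(p v')' - q v = 0` on `[0,1]` with
`b₁ v(0) + b₂ v'(0) = β₀` and `a₁ v(1) + a₂ v'(1) = β₁`. -/
def SolvesBVP (β₀ β₁ : ℝ) (v : ℝ → ℝ) : Prop :=
  ContDiffOn ℝ 2 v (Icc 0 1) ∧
  (∀ x ∈ Icc (0 : ℝ) 1, dx (fun y => S.p y * dx v y) x - S.q x * v x = 0) ∧
  S.bc0 v = β₀ ∧ S.bc1 v = β₁

/-- `v` is the unique solution on `[0,1]` of the boundary value problem. -/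
def IsUniqueBVPSolution (β₀ β₁ : ℝ) (v : ℝ → ℝ) : Prop :=
  S.SolvesBVP β₀ β₁ v ∧ ∀ w, S.SolvesBVP β₀ β₁ w → EqOn w v (Icc 0 1)

/-- The terms of the series in `C₀`. -/
def gainTerm₀ (lam : ℕ → ℝ) (φ : ℕ → ℝ → ℝ) (n : ℕ) : ℝ :=
  1 / lam n ^ 2 * |S.b₁ * dx (φ n) 0 - S.b₂ * φ n 0| ^ 2

/-- The terms of the series in `C₁`. -/
def gainTerm₁ (lam : ℕ → ℝ) (φ : ℕ → ℝ → ℝ) (n : ℕ) : ℝ :=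
  1 / lam n ^ 2 * |S.a₂ * φ n 1 - S.a₁ * dx (φ n) 1| ^ 2

/-- The gain `C₀`. -/
def C₀ (lam : ℕ → ℝ) (φ : ℕ → ℝ → ℝ) : ℝ :=
  S.p 0 / (S.b₁ ^ 2 + S.b₂ ^ 2) * Real.sqrt (∑' n, S.gainTerm₀ lam φ n)

/-- The gain `C₁`. -/
def C₁ (lam : ℕ → ℝ) (φ : ℕ → ℝ → ℝ) : ℝ :=
  S.p 1 / (S.a₁ ^ 2 + S.a₂ ^ 2) * Real.sqrt (∑' n, S.gainTerm₁ lam φ n)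

end SLData

end

/-!
If `0` is not an eigenvalue, the inverse of `A` is a compact symmetric integral operator on
`L²_r(0,1)` whose kernel is Green's function. By the spectral theorem its eigenfunctions, which are
those of `A`, are complete, so Parseval's identity `∑ ⟨φₙ, g⟩² = ‖g‖²` holds in `L²_r(0,1)`.

Green's formula expresses `⟨φₙ, A v⟩ - λₙ ⟨φₙ, v⟩` by the boundary data `β₀`, `β₁` of `v`, with
coefficients `trace₀ φₙ`, `trace₁ φₙ` depending on the boundary values of `φₙ` only. For
`A v = 0` it gives the Fourier coefficients of `v`, and Parseval's identity turns the norms of the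
two stationary solutions into the series for the gains. For a solution `u` of the evolution
equation, the modal amplitudes `cₙ = ⟨φₙ, u⟩` satisfy
`cₙ' = -λₙ cₙ + ⟨φₙ, f⟩ + trace₀ φₙ * d₀ + trace₁ φₙ * d₁`. In Duhamel's formula for `cₙ` the
boundary terms are estimated mode by mode, which leaves the `ℓ²` norm of `trace φₙ / λₙ`, that is
the gain, while the distributed input contributes the integral of an `ℓ²`-valued function. The
factor `λ₀ / (λ₀ - σ)` comes from `1 / (λₙ - σ) ≤ λ₀ / (λ₀ - σ) * (1 / λₙ)`.
-/

/-! ### Initial value problems for globally Lipschitz vector fields -/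

section ODE

open scoped NNReal

variable {E : Type*} [NormedAddCommGroup E] [NormedSpace ℝ E]

/-- The radial retraction of a normed space onto its closed ball of radius `R` around `0`; it
truncates vector fields so that the Picard-Lindelöf theorem applies on a whole interval. -/
noncomputable def radialRetraction (R : ℝ) (x : E) : E := (R / max R ‖x‖) • x

theorem radialRetraction_of_norm_le {R : ℝ} (hR : 0 < R) {x : E} (hx : ‖x‖ ≤ R) :
    radialRetraction R x = x := by
  rw [radialRetraction, max_eq_left hx, div_self hR.ne', one_smul]

theorem norm_radialRetraction {R : ℝ} (hR : 0 < R) (x : E) :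
    ‖radialRetraction R x‖ = R / max R ‖x‖ * ‖x‖ := by
  rw [radialRetraction, norm_smul, Real.norm_of_nonneg (by positivity)]

theorem norm_radialRetraction_le {R : ℝ} (hR : 0 < R) (x : E) : ‖radialRetraction R x‖ ≤ R := by
  rw [norm_radialRetraction hR, div_mul_eq_mul_div, div_le_iff₀ (by positivity)]
  exact mul_le_mul_of_nonneg_left (le_max_right _ _) hR.le

theorem norm_radialRetraction_le_norm {R : ℝ} (hR : 0 < R) (x : E) :
    ‖radialRetraction R x‖ ≤ ‖x‖ := by
  rw [norm_radialRetraction hR]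
  exact mul_le_of_le_one_left (norm_nonneg x) (div_le_one_of_le₀ (le_max_left _ _) (by positivity))

theorem lipschitzWith_radialRetraction {R : ℝ} (hR : 0 < R) :
    LipschitzWith 2 (radialRetraction R : E → E) := by
  refine LipschitzWith.of_dist_le_mul fun x y => ?_
  rw [dist_eq_norm, dist_eq_norm]
  set s := max R ‖x‖
  set t := max R ‖y‖
  have hs : 0 < s := hR.trans_le (le_max_left _ _)
  have ht : 0 < t := hR.trans_le (le_max_left _ _)
  have hst : |t - s| ≤ ‖x - y‖ := by
    have h := (abs_max_sub_max_le_abs ‖y‖ ‖x‖ R).trans (abs_norm_sub_norm_le y x)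
    rwa [max_comm, max_comm ‖x‖, norm_sub_rev] at h
  have split : radialRetraction R x - radialRetraction R y =
      (R / s) • (x - y) + ((t - s) * (R / s) / t) • y := by
    simp only [radialRetraction, smul_sub]
    rw [show (t - s) * (R / s) / t = R / s - R / t by field_simp, sub_smul]
    abel
  have hRs : R / s ≤ 1 := div_le_one_of_le₀ (le_max_left _ _) hs.le
  calc ‖radialRetraction R x - radialRetraction R y‖
      ≤ ‖(R / s) • (x - y)‖ + ‖((t - s) * (R / s) / t) • y‖ := split ▸ norm_add_le _ _
    _ = R / s * ‖x - y‖ + |t - s| * (R / s) * (‖y‖ / t) := by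
        rw [norm_smul, norm_smul, Real.norm_of_nonneg (by positivity), Real.norm_eq_abs, abs_div,
          abs_mul, abs_of_pos ht, abs_of_nonneg (show 0 ≤ R / s by positivity)]
        ring
    _ ≤ 1 * ‖x - y‖ + ‖x - y‖ * 1 * 1 := by
        gcongr
        exact div_le_one_of_le₀ (le_max_right _ _) ht.le
    _ = 2 * ‖x - y‖ := by ring

/-- A bounded vector field satisfies the hypotheses of the Picard-Lindelöf theorem on a ball whose
radius is chosen after the bound. -/
theorem exists_hasDerivWithinAt_of_lipschitzWith_of_bounded [CompleteSpace E] {v : ℝ → E → E}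
    {a b : ℝ} (hab : a ≤ b) {K M : ℝ≥0} (hlip : ∀ t ∈ Icc a b, LipschitzWith K (v t))
    (hcont : ∀ x, ContinuousOn (v · x) (Icc a b)) (hM : ∀ t ∈ Icc a b, ∀ x, ‖v t x‖ ≤ M) (x₀ : E) :
    ∃ z : ℝ → E, z a = x₀ ∧ ∀ t ∈ Icc a b, HasDerivWithinAt z (v t (z t)) (Icc a b) t :=
  IsPicardLindelof.exists_eq_forall_mem_Icc_hasDerivWithinAt₀ (t₀ := ⟨a, left_mem_Icc.2 hab⟩)
    (a := M * (b - a).toNNReal) (L := M) (K := K)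
    { lipschitzOnWith := fun t ht => (hlip t ht).lipschitzOnWith
      continuousOn := fun x _ => hcont x
      norm_le := fun t ht x _ => hM t ht x
      mul_max_le := by simp [hab] }

theorem hasDerivWithinAt_Ici_of_Icc {f : ℝ → E} {f' : E} {a b t : ℝ} (ht : t ∈ Ico a b)
    (hf : HasDerivWithinAt f f' (Icc a b) t) : HasDerivWithinAt f f' (Ici t) t :=
  hf.mono_of_mem_nhdsWithin
    (mem_of_superset (Icc_mem_nhdsGE ht.2) (Icc_subset_Icc_left ht.1))

theorem exists_hasDerivWithinAt_of_lipschitzWith [CompleteSpace E] {v : ℝ → E → E} {a b : ℝ}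
    (hab : a ≤ b) {K : ℝ≥0} (hlip : ∀ t ∈ Icc a b, LipschitzWith K (v t))
    (hcont : ∀ x, ContinuousOn (v · x) (Icc a b)) (x₀ : E) :
    ∃ z : ℝ → E, z a = x₀ ∧ ∀ t ∈ Icc a b, HasDerivWithinAt z (v t (z t)) (Icc a b) t := by
  obtain ⟨M, hM⟩ := isCompact_Icc.exists_bound_of_continuousOn (hcont 0)
  have hM0 : 0 ≤ M := (norm_nonneg _).trans (hM a (left_mem_Icc.2 hab))
  have growth : ∀ t ∈ Icc a b, ∀ x, ‖v t x‖ ≤ K * ‖x‖ + M := fun t ht x => by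
    have h := (hlip t ht).norm_sub_le x 0
    rw [sub_zero] at h
    linarith [norm_le_norm_sub_add (v t x) (v t 0), hM t ht]
  -- By Grönwall, solutions of the truncated equation stay in the ball where it is not truncated.
  set R := gronwallBound ‖x₀‖ K M (b - a) + 1
  have hmono : Monotone (gronwallBound ‖x₀‖ K M) := gronwallBound_mono (norm_nonneg _) hM0 K.2
  have hR : 0 < R := by
    have h := hmono (sub_nonneg.2 hab)
    rw [gronwallBound_x0] at h
    positivity [(norm_nonneg x₀).trans h]
  obtain ⟨z, hz₀, hz⟩ := exists_hasDerivWithinAt_of_lipschitzWith_of_bounded hab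
    (v := fun t x => v t (radialRetraction R x)) (M := K * R.toNNReal + M.toNNReal)
    (fun t ht => (hlip t ht).comp (lipschitzWith_radialRetraction hR)) (fun x => hcont _)
    (fun t ht x => (growth t ht _).trans (by
      push_cast
      rw [Real.coe_toNNReal _ hR.le, Real.coe_toNNReal _ hM0]
      gcongr
      exact norm_radialRetraction_le hR x)) x₀
  have hzR : ∀ t ∈ Icc a b, ‖z t‖ ≤ R := fun t ht => by
    have h := norm_le_gronwallBound_of_norm_deriv_right_le
      (fun s hs => (hz s hs).continuousWithinAt)
      (fun s hs => hasDerivWithinAt_Ici_of_Icc hs (hz s (Ico_subset_Icc_self hs)))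
      (congrArg _ hz₀).le (fun s hs => (growth s (Ico_subset_Icc_self hs) _).trans
        (by gcongr; exact norm_radialRetraction_le_norm hR _)) t ht
    linarith [hmono (sub_le_sub_right ht.2 a)]
  refine ⟨z, hz₀, fun t ht => ?_⟩
  simpa only [radialRetraction_of_norm_le hR (hzR t ht)] using hz t ht

theorem eqOn_of_hasDerivWithinAt_of_lipschitzWith {v : ℝ → E → E} {a b : ℝ} {K : ℝ≥0}
    (hlip : ∀ t ∈ Icc a b, LipschitzWith K (v t)) {y z : ℝ → E}
    (hy : ∀ t ∈ Icc a b, HasDerivWithinAt y (v t (y t)) (Icc a b) t)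
    (hz : ∀ t ∈ Icc a b, HasDerivWithinAt z (v t (z t)) (Icc a b) t) (ha : y a = z a) :
    EqOn y z (Icc a b) :=
  ODE_solution_unique_of_mem_Icc_right (s := fun _ => univ)
    (fun t ht => (hlip t (Ico_subset_Icc_self ht)).lipschitzOnWith)
    (fun t ht => (hy t ht).continuousWithinAt)
    (fun t ht => hasDerivWithinAt_Ici_of_Icc ht (hy t (Ico_subset_Icc_self ht)))
    (fun _ _ => mem_univ _) (fun t ht => (hz t ht).continuousWithinAt)
    (fun t ht => hasDerivWithinAt_Ici_of_Icc ht (hz t (Ico_subset_Icc_self ht)))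
    (fun _ _ => mem_univ _) ha

end ODE

/-! ### Sturm-Liouville expressions on `[0,1]` -/

theorem hasDerivWithinAt_integral_right {f : ℝ → ℝ} {a b x : ℝ} (hf : ContinuousOn f (Icc a b))
    (hx : x ∈ Icc a b) : HasDerivWithinAt (fun y => ∫ z in a..y, f z) (f x) (Icc a b) x :=
  haveI : Fact (x ∈ Icc a b) := ⟨hx⟩
  intervalIntegral.integral_hasDerivWithinAt_right
    ((hf.mono (Icc_subset_Icc_right hx.2)).intervalIntegrable_of_Icc hx.1)
    (hf.stronglyMeasurableAtFilter_nhdsWithin measurableSet_Icc x) (hf x hx)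

theorem hasDerivWithinAt_integral_left {f : ℝ → ℝ} {a b x : ℝ} (hf : ContinuousOn f (Icc a b))
    (hx : x ∈ Icc a b) : HasDerivWithinAt (fun y => ∫ z in y..b, f z) (-f x) (Icc a b) x :=
  haveI : Fact (x ∈ Icc a b) := ⟨hx⟩
  intervalIntegral.integral_hasDerivWithinAt_left
    ((hf.mono (Icc_subset_Icc_left hx.1)).intervalIntegrable_of_Icc hx.2)
    (hf.stronglyMeasurableAtFilter_nhdsWithin measurableSet_Icc x) (hf x hx)

theorem integral_eq_sub_of_hasDerivWithinAt {F f : ℝ → ℝ} {a b : ℝ} (hab : a ≤ b)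
    (hF : ∀ x ∈ Icc a b, HasDerivWithinAt F (f x) (Icc a b) x) (hf : ContinuousOn f (Icc a b)) :
    ∫ x in a..b, f x = F b - F a :=
  intervalIntegral.integral_eq_sub_of_hasDerivAt_of_le hab
    (fun x hx => (hF x hx).continuousWithinAt)
    (fun x hx => (hF x (Ioo_subset_Icc_self hx)).hasDerivAt (Icc_mem_nhds hx.1 hx.2))
    (hf.intervalIntegrable_of_Icc hab)

theorem dx_eq_of_hasDerivWithinAt {g : ℝ → ℝ} {l x : ℝ} (h : HasDerivWithinAt g l (Icc 0 1) x)
    (hx : x ∈ Icc (0 : ℝ) 1) : dx g x = l :=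
  h.derivWithin (uniqueDiffOn_Icc_zero_one x hx)

theorem hasDerivWithinAt_dx {g : ℝ → ℝ} (hg : DifferentiableOn ℝ g (Icc 0 1)) {x : ℝ}
    (hx : x ∈ Icc (0 : ℝ) 1) : HasDerivWithinAt g (dx g x) (Icc 0 1) x :=
  (hg x hx).hasDerivWithinAt

theorem dx_congr {g h : ℝ → ℝ} (hgh : EqOn g h (Icc 0 1)) {x : ℝ} (hx : x ∈ Icc (0 : ℝ) 1) :
    dx g x = dx h x :=
  derivWithin_congr hgh (hgh hx)

theorem dx_linearCombination {g h : ℝ → ℝ} (hg : DifferentiableOn ℝ g (Icc 0 1))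
    (hh : DifferentiableOn ℝ h (Icc 0 1)) (a b : ℝ) {x : ℝ} (hx : x ∈ Icc (0 : ℝ) 1) :
    dx (fun y => a * g y + b * h y) x = a * dx g x + b * dx h x :=
  dx_eq_of_hasDerivWithinAt
    (((hasDerivWithinAt_dx hg hx).const_mul a).add ((hasDerivWithinAt_dx hh hx).const_mul b)) hx

theorem contDiffOn_linearCombination {g h : ℝ → ℝ} {n : WithTop ℕ∞} {s : Set ℝ}
    (hg : ContDiffOn ℝ n g s) (hh : ContDiffOn ℝ n h s) (a b : ℝ) :
    ContDiffOn ℝ n (fun x => a * g x + b * h x) s :=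
  (contDiffOn_const.mul hg).add (contDiffOn_const.mul hh)

theorem inH2_of_contDiffOn {g : ℝ → ℝ} (hg : ContDiffOn ℝ 2 g (Icc 0 1)) : InH2 g := by
  have hdx : ContDiffOn ℝ 1 (dx g) (Icc 0 1) :=
    hg.derivWithin uniqueDiffOn_Icc_zero_one (by norm_num)
  have hdxx : ContinuousOn (dx (dx g)) (Icc 0 1) :=
    hdx.continuousOn_derivWithin uniqueDiffOn_Icc_zero_one le_rfl
  refine ⟨hg.of_le one_le_two, dx (dx g), (memLp_two_iff_integrable_sq
    (hdxx.aestronglyMeasurable measurableSet_Icc)).2 (hdxx.pow 2).integrableOn_Icc, fun x hx => ?_⟩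
  have hsub : Icc 0 x ⊆ Icc (0 : ℝ) 1 := Icc_subset_Icc_right hx.2
  rw [integral_eq_sub_of_hasDerivWithinAt hx.1 (fun y hy => (hasDerivWithinAt_dx
    (hdx.differentiableOn one_ne_zero) (hsub hy)).mono hsub) (hdxx.mono hsub), add_sub_cancel]

theorem sq_add_sq_pos_of_abs_add_abs_pos {a b : ℝ} (h : 0 < |a| + |b|) : 0 < a ^ 2 + b ^ 2 := by
  by_contra! hle
  have ha : a = 0 := by nlinarith [sq_nonneg a, sq_nonneg b]
  have hb : b = 0 := by nlinarith [sq_nonneg a, sq_nonneg b]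
  simp [ha, hb] at h

namespace SLData

variable (S : SLData)

/-- The flux `p g'`, whose derivative enters the Sturm-Liouville expression. -/
noncomputable def flux (g : ℝ → ℝ) (x : ℝ) : ℝ := S.p x * dx g x

/-- The Wronskian `g (p h') - h (p g')`. -/
noncomputable def wronskian (g h : ℝ → ℝ) (x : ℝ) : ℝ := g x * S.flux h x - h x * S.flux g x

/-- The inner product `∫₀¹ r g h` of `L²_r(0,1)` on the level of functions. -/
noncomputable def wInner (g h : ℝ → ℝ) : ℝ := ∫ x in (0 : ℝ)..1, S.r x * g x * h x

/-- The linear functional of the boundary values at `0` which is conjugate to `S.bc0` in Green's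
formula. -/
noncomputable def trace₀ (φ : ℝ → ℝ) : ℝ :=
  S.p 0 * (S.b₁ * dx φ 0 - S.b₂ * φ 0) / (S.b₁ ^ 2 + S.b₂ ^ 2)

/-- The linear functional of the boundary values at `1` which is conjugate to `S.bc1` in Green's
formula. -/
noncomputable def trace₁ (φ : ℝ → ℝ) : ℝ :=
  S.p 1 * (S.a₂ * φ 1 - S.a₁ * dx φ 1) / (S.a₁ ^ 2 + S.a₂ ^ 2)

theorem p_ne_zero {x : ℝ} (hx : x ∈ Icc (0 : ℝ) 1) : S.p x ≠ 0 := (S.p_pos x hx).ne'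

theorem r_ne_zero {x : ℝ} (hx : x ∈ Icc (0 : ℝ) 1) : S.r x ≠ 0 := (S.r_pos x hx).ne'

theorem b_sq_pos : 0 < S.b₁ ^ 2 + S.b₂ ^ 2 := sq_add_sq_pos_of_abs_add_abs_pos S.b_pos

theorem a_sq_pos : 0 < S.a₁ ^ 2 + S.a₂ ^ 2 := sq_add_sq_pos_of_abs_add_abs_pos S.a_pos

variable {S} {g h φ : ℝ → ℝ}

theorem contDiffOn_flux (hg : ContDiffOn ℝ 2 g (Icc 0 1)) : ContDiffOn ℝ 1 (S.flux g) (Icc 0 1) :=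
  S.p_contDiffOn.mul (hg.derivWithin uniqueDiffOn_Icc_zero_one (by norm_num))

theorem dx_flux {x : ℝ} (hx : x ∈ Icc (0 : ℝ) 1) :
    dx (S.flux g) x = S.q x * g x - S.r x * S.A g x := by
  change dx (fun y => S.p y * dx g y) x = _
  rw [A]
  field_simp [S.r_ne_zero hx]
  ring

theorem hasDerivWithinAt_flux (hg : ContDiffOn ℝ 2 g (Icc 0 1)) {x : ℝ} (hx : x ∈ Icc (0 : ℝ) 1) :
    HasDerivWithinAt (S.flux g) (S.q x * g x - S.r x * S.A g x) (Icc 0 1) x :=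
  dx_flux hx ▸ hasDerivWithinAt_dx ((contDiffOn_flux hg).differentiableOn one_ne_zero) hx

theorem continuousOn_A (hg : ContDiffOn ℝ 2 g (Icc 0 1)) : ContinuousOn (S.A g) (Icc 0 1) := by
  have hr : ∀ x ∈ Icc (0 : ℝ) 1, S.r x ≠ 0 := fun x hx => S.r_ne_zero hx
  have hflux : ContinuousOn (dx (S.flux g)) (Icc 0 1) :=
    (contDiffOn_flux hg).continuousOn_derivWithin uniqueDiffOn_Icc_zero_one le_rfl
  exact ((continuousOn_const.div S.r_continuousOn hr).neg.mul hflux).add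
    ((S.q_continuousOn.div S.r_continuousOn hr).mul hg.continuousOn)

theorem A_linearCombination (hg : ContDiffOn ℝ 2 g (Icc 0 1)) (hh : ContDiffOn ℝ 2 h (Icc 0 1))
    (a b : ℝ) {x : ℝ} (hx : x ∈ Icc (0 : ℝ) 1) :
    S.A (fun x => a * g x + b * h x) x = a * S.A g x + b * S.A h x := by
  have hflux : EqOn (S.flux fun x => a * g x + b * h x)
      (fun x => a * S.flux g x + b * S.flux h x) (Icc 0 1) := fun y hy => by
    simp only [flux]
    rw [dx_linearCombination (hg.differentiableOn two_ne_zero) (hh.differentiableOn two_ne_zero)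
      a b hy]
    ring
  have hderiv := dx_congr hflux hx
  rw [dx_linearCombination ((contDiffOn_flux hg).differentiableOn one_ne_zero)
    ((contDiffOn_flux hh).differentiableOn one_ne_zero) a b hx, dx_flux hx, dx_flux hx,
    dx_flux hx] at hderiv
  refine mul_left_cancel₀ (S.r_ne_zero hx) ?_
  linear_combination -hderiv

theorem bc0_linearCombination (hg : DifferentiableOn ℝ g (Icc 0 1))
    (hh : DifferentiableOn ℝ h (Icc 0 1)) (a b : ℝ) :
    S.bc0 (fun x => a * g x + b * h x) = a * S.bc0 g + b * S.bc0 h := by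
  simp only [bc0]
  rw [dx_linearCombination hg hh a b (left_mem_Icc.2 zero_le_one)]
  ring

theorem bc1_linearCombination (hg : DifferentiableOn ℝ g (Icc 0 1))
    (hh : DifferentiableOn ℝ h (Icc 0 1)) (a b : ℝ) :
    S.bc1 (fun x => a * g x + b * h x) = a * S.bc1 g + b * S.bc1 h := by
  simp only [bc1]
  rw [dx_linearCombination hg hh a b (right_mem_Icc.2 zero_le_one)]
  ring

theorem contDiffOn_and_A_eqOn_of_hasDerivWithinAt {w k : ℝ → ℝ}
    (hg : ∀ x ∈ Icc (0 : ℝ) 1, HasDerivWithinAt g (w x / S.p x) (Icc 0 1) x)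
    (hw : ∀ x ∈ Icc (0 : ℝ) 1, HasDerivWithinAt w (S.q x * g x - S.r x * k x) (Icc 0 1) x)
    (hk : ContinuousOn k (Icc 0 1)) :
    ContDiffOn ℝ 2 g (Icc 0 1) ∧ EqOn (S.A g) k (Icc 0 1) := by
  have hdx : ∀ x ∈ Icc (0 : ℝ) 1, dx g x = w x / S.p x :=
    fun x hx => dx_eq_of_hasDerivWithinAt (hg x hx) hx
  have hflux : EqOn (S.flux g) w (Icc 0 1) := fun x hx => by
    rw [flux, hdx x hx, mul_div_cancel₀ _ (S.p_ne_zero hx)]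
  have hw' : ContinuousOn (fun x => S.q x * g x - S.r x * k x) (Icc 0 1) :=
    (S.q_continuousOn.mul fun x hx => (hg x hx).continuousWithinAt).sub (S.r_continuousOn.mul hk)
  have hw1 : ContDiffOn ℝ 1 w (Icc 0 1) :=
    (contDiffOn_one_iff_derivWithin uniqueDiffOn_Icc_zero_one).2
      ⟨fun x hx => (hw x hx).differentiableWithinAt,
        hw'.congr fun x hx => dx_eq_of_hasDerivWithinAt (hw x hx) hx⟩
  refine ⟨?_, fun x hx => ?_⟩
  · rw [show (2 : WithTop ℕ∞) = 1 + 1 by norm_num,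
      contDiffOn_succ_iff_derivWithin uniqueDiffOn_Icc_zero_one]
    exact ⟨fun x hx => (hg x hx).differentiableWithinAt, by simp,
      (hw1.div S.p_contDiffOn fun x hx => S.p_ne_zero hx).congr hdx⟩
  · have h := (dx_congr hflux hx).trans (dx_eq_of_hasDerivWithinAt (hw x hx) hx)
    rw [dx_flux hx] at h
    exact mul_left_cancel₀ (S.r_ne_zero hx) (by linarith)

theorem hasDerivWithinAt_wronskian (hg : ContDiffOn ℝ 2 g (Icc 0 1))
    (hh : ContDiffOn ℝ 2 h (Icc 0 1)) {x : ℝ} (hx : x ∈ Icc (0 : ℝ) 1) :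
    HasDerivWithinAt (S.wronskian g h) (S.r x * h x * S.A g x - S.r x * S.A h x * g x)
      (Icc 0 1) x := by
  have hg' := hasDerivWithinAt_dx (hg.differentiableOn two_ne_zero) hx
  have hh' := hasDerivWithinAt_dx (hh.differentiableOn two_ne_zero) hx
  refine ((hg'.mul (hasDerivWithinAt_flux (S := S) hh hx)).sub
    (hh'.mul (hasDerivWithinAt_flux (S := S) hg hx))).congr_deriv ?_
  simp only [flux]
  ring

theorem wronskian_zero_eq (g : ℝ → ℝ) (hφ : S.bc0 φ = 0) :
    S.wronskian g φ 0 = S.trace₀ φ * S.bc0 g := by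
  have hb := S.b_sq_pos.ne'
  simp only [wronskian, flux, trace₀, bc0] at hφ ⊢
  field_simp
  linear_combination S.p 0 * (g 0 * S.b₂ - dx g 0 * S.b₁) * hφ

theorem wronskian_one_eq (g : ℝ → ℝ) (hφ : S.bc1 φ = 0) :
    S.wronskian g φ 1 = -(S.trace₁ φ * S.bc1 g) := by
  have ha := S.a_sq_pos.ne'
  simp only [wronskian, flux, trace₁, bc1] at hφ ⊢
  field_simp
  linear_combination S.p 1 * (g 1 * S.a₂ - dx g 1 * S.a₁) * hφ

theorem wInner_comm (g h : ℝ → ℝ) : S.wInner g h = S.wInner h g := by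
  simp only [wInner, mul_right_comm]

theorem wInner_A (hφ : ContDiffOn ℝ 2 φ (Icc 0 1)) (hφ0 : S.bc0 φ = 0) (hφ1 : S.bc1 φ = 0)
    (hg : ContDiffOn ℝ 2 g (Icc 0 1)) :
    S.wInner φ (S.A g) = S.wInner (S.A φ) g - S.trace₀ φ * S.bc0 g - S.trace₁ φ * S.bc1 g := by
  have hc₁ : ContinuousOn (fun x => S.r x * φ x * S.A g x) (Icc 0 1) :=
    (S.r_continuousOn.mul hφ.continuousOn).mul (continuousOn_A hg)
  have hc₂ : ContinuousOn (fun x => S.r x * S.A φ x * g x) (Icc 0 1) :=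
    (S.r_continuousOn.mul (continuousOn_A hφ)).mul hg.continuousOn
  have lagrange : S.wInner φ (S.A g) - S.wInner (S.A φ) g =
      S.wronskian g φ 1 - S.wronskian g φ 0 := by
    rw [wInner, wInner, ← intervalIntegral.integral_sub
      (hc₁.intervalIntegrable_of_Icc zero_le_one) (hc₂.intervalIntegrable_of_Icc zero_le_one)]
    exact integral_eq_sub_of_hasDerivWithinAt zero_le_one
      (fun x hx => hasDerivWithinAt_wronskian hg hφ hx) (hc₁.sub hc₂)
  rw [wronskian_zero_eq g hφ0, wronskian_one_eq g hφ1] at lagrange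
  linarith

end SLData

/-! ### The homogeneous equation and Green's kernel -/

namespace SLData

open scoped NNReal

variable {S : SLData} {g h v w : ℝ → ℝ} {μ : ℝ}

/-- `v ∈ C²([0,1])` satisfies `A v = μ v` on `[0,1]`. -/
structure SolvesODE (S : SLData) (μ : ℝ) (v : ℝ → ℝ) : Prop where
  contDiffOn : ContDiffOn ℝ 2 v (Icc 0 1)
  A_eq : ∀ x ∈ Icc (0 : ℝ) 1, S.A v x = μ * v x

/-- The vector field of the first-order system for `(v, p v')` equivalent to `A v = μ v`. -/
noncomputable def system (S : SLData) (μ x : ℝ) (z : ℝ × ℝ) : ℝ × ℝ :=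
  (z.2 / S.p x, (S.q x - μ * S.r x) * z.1)

theorem continuousOn_system (S : SLData) (μ : ℝ) (z : ℝ × ℝ) :
    ContinuousOn (S.system μ · z) (Icc 0 1) :=
  (continuousOn_const.div S.p_contDiffOn.continuousOn fun _ hx => S.p_ne_zero hx).prodMk
    ((S.q_continuousOn.sub (continuousOn_const.mul S.r_continuousOn)).mul continuousOn_const)

theorem exists_lipschitzWith_system (S : SLData) (μ : ℝ) :
    ∃ K : ℝ≥0, ∀ x ∈ Icc (0 : ℝ) 1, LipschitzWith K (S.system μ x) := by
  obtain ⟨K₁, hK₁⟩ := isCompact_Icc.exists_bound_of_continuousOn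
    (S.p_contDiffOn.continuousOn.inv₀ fun _ hx => S.p_ne_zero hx)
  obtain ⟨K₂, hK₂⟩ := isCompact_Icc.exists_bound_of_continuousOn
    (S.q_continuousOn.sub (continuousOn_const.mul S.r_continuousOn) :
      ContinuousOn (fun x => S.q x - μ * S.r x) (Icc 0 1))
  refine ⟨max K₁.toNNReal K₂.toNNReal, fun x hx => LipschitzWith.prodMk ?_ ?_⟩
  · refine LipschitzWith.of_dist_le_mul fun y z => ?_
    rw [Real.dist_eq, ← sub_div, div_eq_inv_mul, abs_mul, ← Real.dist_eq, Prod.dist_eq]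
    gcongr
    · exact (hK₁ x hx).trans (Real.le_coe_toNNReal _)
    · exact le_max_right _ _
  · refine LipschitzWith.of_dist_le_mul fun y z => ?_
    rw [Real.dist_eq, ← mul_sub, abs_mul, ← Real.dist_eq, Prod.dist_eq]
    gcongr
    · exact (hK₂ x hx).trans (Real.le_coe_toNNReal _)
    · exact le_max_left _ _

theorem exists_solvesODE (S : SLData) (μ α β : ℝ) :
    ∃ v, S.SolvesODE μ v ∧ v 0 = α ∧ dx v 0 = β := by
  obtain ⟨K, hK⟩ := S.exists_lipschitzWith_system μ
  obtain ⟨z, hz₀, hz⟩ := exists_hasDerivWithinAt_of_lipschitzWith zero_le_one hK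
    (S.continuousOn_system μ) (α, S.p 0 * β)
  have hv : ∀ x ∈ Icc (0 : ℝ) 1,
      HasDerivWithinAt (fun x => (z x).1) ((z x).2 / S.p x) (Icc 0 1) x := fun x hx =>
    (hasFDerivAt_fst (𝕜 := ℝ) (p := z x)).comp_hasDerivWithinAt x (hz x hx)
  have hflux : ∀ x ∈ Icc (0 : ℝ) 1, HasDerivWithinAt (fun x => (z x).2)
      (S.q x * (z x).1 - S.r x * (μ * (z x).1)) (Icc 0 1) x := fun x hx =>
    ((hasFDerivAt_snd (𝕜 := ℝ) (p := z x)).comp_hasDerivWithinAt x (hz x hx)).congr_deriv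
      (show (S.q x - μ * S.r x) * (z x).1 = _ by ring)
  obtain ⟨hC2, hA⟩ := contDiffOn_and_A_eqOn_of_hasDerivWithinAt hv hflux
    (continuousOn_const.mul fun x hx => (hv x hx).continuousWithinAt)
  have h0 : (0 : ℝ) ∈ Icc (0 : ℝ) 1 := left_mem_Icc.2 zero_le_one
  refine ⟨fun x => (z x).1, ⟨hC2, hA⟩, by simp only [hz₀], ?_⟩
  rw [dx_eq_of_hasDerivWithinAt (hv 0 h0) h0]
  simp only [hz₀]
  rw [mul_div_cancel_left₀ _ (S.p_ne_zero h0)]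

namespace SolvesODE

theorem linearCombination (hv : S.SolvesODE μ v) (hw : S.SolvesODE μ w) (a b : ℝ) :
    S.SolvesODE μ fun x => a * v x + b * w x where
  contDiffOn := contDiffOn_linearCombination hv.contDiffOn hw.contDiffOn a b
  A_eq x hx := by
    rw [A_linearCombination hv.contDiffOn hw.contDiffOn a b hx, hv.A_eq x hx, hw.A_eq x hx]
    ring

theorem hasDerivWithinAt_system (hv : S.SolvesODE μ v) {x : ℝ} (hx : x ∈ Icc (0 : ℝ) 1) :
    HasDerivWithinAt (fun y => (v y, S.flux v y)) (S.system μ x (v x, S.flux v x))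
      (Icc 0 1) x := by
  refine ((hasDerivWithinAt_dx (hv.contDiffOn.differentiableOn two_ne_zero) hx).prodMk
    (hasDerivWithinAt_flux hv.contDiffOn hx)).congr_deriv (Prod.ext ?_ ?_)
  · exact (mul_div_cancel_left₀ _ (S.p_ne_zero hx)).symm
  · simp only [system, hv.A_eq x hx]
    ring

theorem eqOn_of_initial (hv : S.SolvesODE μ v) (hw : S.SolvesODE μ w) (h : v 0 = w 0)
    (h' : dx v 0 = dx w 0) : EqOn v w (Icc 0 1) := by
  obtain ⟨K, hK⟩ := S.exists_lipschitzWith_system μ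
  have key := eqOn_of_hasDerivWithinAt_of_lipschitzWith hK
    (fun _ hx => hv.hasDerivWithinAt_system hx) (fun _ hx => hw.hasDerivWithinAt_system hx)
    (by simp only [flux, h, h'])
  exact fun x hx => congrArg Prod.fst (key hx)

theorem wronskian_eq (hv : S.SolvesODE μ v) (hw : S.SolvesODE μ w) {x : ℝ}
    (hx : x ∈ Icc (0 : ℝ) 1) : S.wronskian v w x = S.wronskian v w 0 := by
  have hderiv : ∀ y ∈ Icc (0 : ℝ) 1, HasDerivWithinAt (S.wronskian v w) 0 (Icc 0 1) y :=
    fun y hy => (hasDerivWithinAt_wronskian hv.contDiffOn hw.contDiffOn hy).congr_deriv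
      (by rw [hv.A_eq y hy, hw.A_eq y hy]; ring)
  exact constant_of_derivWithin_zero (fun y hy => (hderiv y hy).differentiableWithinAt)
    (fun y hy => dx_eq_of_hasDerivWithinAt (hderiv y (Ico_subset_Icc_self hy))
      (Ico_subset_Icc_self hy)) x hx

theorem isEigenvalue (hv : S.SolvesODE μ v) (h0 : S.bc0 v = 0) (h1 : S.bc1 v = 0)
    (hne : ∃ x ∈ Icc (0 : ℝ) 1, v x ≠ 0) : S.IsEigenvalue μ :=
  ⟨v, ⟨inH2_of_contDiffOn hv.contDiffOn, h0, h1⟩, hne,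
    (ae_restrict_iff' measurableSet_Ioo).2
      (Eventually.of_forall fun x hx => hv.A_eq x (Ioo_subset_Icc_self hx))⟩

theorem eqOn_const_mul_of_trace₀_eq (hv : S.SolvesODE μ v) (hw : S.SolvesODE μ w)
    (hv0 : S.bc0 v = 0) (hw0 : S.bc0 w = 0) {c : ℝ} (hc : S.trace₀ v = c * S.trace₀ w) :
    EqOn v (fun x => c * w x) (Icc 0 1) := by
  have h0 : (0 : ℝ) ∈ Icc (0 : ℝ) 1 := left_mem_Icc.2 zero_le_one
  have hb := S.b_sq_pos.ne'
  have hp := S.p_ne_zero h0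
  have hcw : S.SolvesODE μ fun x => c * w x := by
    simpa only [zero_mul, add_zero] using hw.linearCombination hw c 0
  have hdx : dx (fun x => c * w x) 0 = c * dx w 0 := dx_eq_of_hasDerivWithinAt
    ((hasDerivWithinAt_dx (hw.contDiffOn.differentiableOn two_ne_zero) h0).const_mul c) h0
  simp only [trace₀, bc0] at hv0 hw0 hc
  field_simp at hc
  refine hv.eqOn_of_initial hcw (mul_left_cancel₀ hb ?_) (mul_left_cancel₀ hb ?_)
  · linear_combination S.b₁ * hv0 - S.b₂ * hc - c * S.b₁ * hw0
  · rw [hdx]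
    linear_combination S.b₂ * hv0 + S.b₁ * hc - c * S.b₂ * hw0

theorem eqOn_const_mul_of_bc0 (hv : S.SolvesODE μ v) (hw : S.SolvesODE μ w) (hv0 : S.bc0 v = 0)
    (hw0 : S.bc0 w = 0) (hne : ∃ x ∈ Icc (0 : ℝ) 1, w x ≠ 0) :
    ∃ c : ℝ, EqOn v (fun x => c * w x) (Icc 0 1) := by
  have htrace : S.trace₀ w ≠ 0 := fun h => by
    obtain ⟨x, hx, hwx⟩ := hne
    refine hwx ((hw.eqOn_const_mul_of_trace₀_eq hw hw0 hw0 (c := 0) ?_ hx).trans (zero_mul _))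
    rw [h, mul_zero]
  exact ⟨_, hv.eqOn_const_mul_of_trace₀_eq hw hv0 hw0 (div_mul_cancel₀ _ htrace).symm⟩

end SolvesODE

theorem eqOn_of_A_eqOn (h0 : ¬S.IsEigenvalue 0) (hg : ContDiffOn ℝ 2 g (Icc 0 1))
    (hh : ContDiffOn ℝ 2 h (Icc 0 1)) (hbc0 : S.bc0 g = S.bc0 h) (hbc1 : S.bc1 g = S.bc1 h)
    (hA : EqOn (S.A g) (S.A h) (Icc 0 1)) : EqOn g h (Icc 0 1) := fun x hx => by
  by_contra hne
  have hg' := hg.differentiableOn two_ne_zero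
  have hh' := hh.differentiableOn two_ne_zero
  have hdiff : S.SolvesODE 0 fun y => 1 * g y + -1 * h y :=
    ⟨contDiffOn_linearCombination hg hh 1 (-1), fun y hy => by
      rw [A_linearCombination hg hh 1 (-1) hy, hA hy]; ring⟩
  refine h0 (hdiff.isEigenvalue ?_ ?_ ⟨x, hx, fun hx0 => hne (by linarith)⟩)
  · rw [bc0_linearCombination hg' hh', hbc0]; ring
  · rw [bc1_linearCombination hg' hh', hbc1]; ring

/-- Two solutions of the homogeneous equation `A v = 0`, each satisfying the boundary condition at
one end, normalized by their Wronskian: `v₁ (min x y) * v₂ (max x y)` is Green's kernel of `A`. -/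
structure IsFundamental (S : SLData) (v₁ v₂ : ℝ → ℝ) : Prop where
  solvesODE₁ : S.SolvesODE 0 v₁
  solvesODE₂ : S.SolvesODE 0 v₂
  bc0_eq : S.bc0 v₁ = 0
  bc1_eq : S.bc1 v₂ = 0
  wronskian_eq : ∀ x ∈ Icc (0 : ℝ) 1, S.wronskian v₂ v₁ x = 1

theorem exists_isFundamental (h0 : ¬S.IsEigenvalue 0) : ∃ v₁ v₂, S.IsFundamental v₁ v₂ := by
  have hmem : (0 : ℝ) ∈ Icc (0 : ℝ) 1 := left_mem_Icc.2 zero_le_one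
  have hb := S.b_sq_pos.ne'
  have hp := S.p_ne_zero hmem
  obtain ⟨v, hv, hv0, hv0'⟩ := S.exists_solvesODE 0 (-S.b₂) S.b₁
  obtain ⟨y, hy, hy0, hy0'⟩ := S.exists_solvesODE 0 S.b₁ S.b₂
  have hv_bc0 : S.bc0 v = 0 := by rw [bc0, hv0, hv0']; ring
  have hwronskian : S.wronskian y v 0 = S.p 0 * (S.b₁ ^ 2 + S.b₂ ^ 2) := by
    rw [wronskian, flux, flux, hy0, hy0', hv0, hv0']; ring
  have hv_bc1 : S.bc1 v ≠ 0 := fun hv_bc1 => by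
    have hzero : EqOn v (fun _ => 0) (Icc 0 1) := fun x hx => by
      by_contra hne
      exact h0 (hv.isEigenvalue hv_bc0 hv_bc1 ⟨x, hx, hne⟩)
    have hdx : dx v 0 = 0 := (dx_congr hzero hmem).trans
      (dx_eq_of_hasDerivWithinAt (hasDerivWithinAt_const _ _ _) hmem)
    rw [wronskian, flux, flux, hdx, hzero hmem] at hwronskian
    exact mul_ne_zero hp hb (by linarith)
  set a := (S.p 0 * (S.b₁ ^ 2 + S.b₂ ^ 2))⁻¹
  have hw := hy.linearCombination hv a (-(a * S.bc1 y / S.bc1 v))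
  refine ⟨v, _, hv, hw, hv_bc0, ?_, fun x hx => ?_⟩
  · rw [bc1_linearCombination (hy.contDiffOn.differentiableOn two_ne_zero)
      (hv.contDiffOn.differentiableOn two_ne_zero), neg_mul, div_mul_cancel₀ _ hv_bc1,
      add_neg_cancel]
  · rw [hw.wronskian_eq hv hx, wronskian, flux, flux,
      dx_linearCombination (hy.contDiffOn.differentiableOn two_ne_zero)
        (hv.contDiffOn.differentiableOn two_ne_zero) _ _ hmem]
    rw [wronskian, flux, flux] at hwronskian
    linear_combination a * hwronskian + inv_mul_cancel₀ (mul_ne_zero hp hb)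

/-- The solution of `A g = k` with homogeneous boundary conditions given by Green's kernel
(variation of constants). -/
noncomputable def greenSolution (S : SLData) (v₁ v₂ k : ℝ → ℝ) (x : ℝ) : ℝ :=
  v₂ x * (∫ y in (0 : ℝ)..x, S.r y * v₁ y * k y) + v₁ x * ∫ y in x..1, S.r y * v₂ y * k y

namespace IsFundamental

variable {v₁ v₂ k : ℝ → ℝ} {x : ℝ}

theorem hasDerivWithinAt_mul_integral_add {a₁ a₂ : ℝ → ℝ} {a₁' a₂' : ℝ}
    (hv : S.IsFundamental v₁ v₂) (hk : ContinuousOn k (Icc 0 1)) (hx : x ∈ Icc (0 : ℝ) 1)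
    (ha₁ : HasDerivWithinAt a₁ a₁' (Icc 0 1) x) (ha₂ : HasDerivWithinAt a₂ a₂' (Icc 0 1) x) :
    HasDerivWithinAt (fun x => a₂ x * (∫ y in (0 : ℝ)..x, S.r y * v₁ y * k y) +
        a₁ x * ∫ y in x..1, S.r y * v₂ y * k y)
      (a₂' * (∫ y in (0 : ℝ)..x, S.r y * v₁ y * k y) + a₁' * (∫ y in x..1, S.r y * v₂ y * k y) +
        S.r x * k x * (a₂ x * v₁ x - a₁ x * v₂ x)) (Icc 0 1) x := by
  have h₁ : ContinuousOn (fun y => S.r y * v₁ y * k y) (Icc 0 1) :=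
    (S.r_continuousOn.mul hv.solvesODE₁.contDiffOn.continuousOn).mul hk
  have h₂ : ContinuousOn (fun y => S.r y * v₂ y * k y) (Icc 0 1) :=
    (S.r_continuousOn.mul hv.solvesODE₂.contDiffOn.continuousOn).mul hk
  exact ((ha₂.mul (hasDerivWithinAt_integral_right h₁ hx)).add
    (ha₁.mul (hasDerivWithinAt_integral_left h₂ hx))).congr_deriv (by ring)

theorem hasDerivWithinAt_greenSolution (hv : S.IsFundamental v₁ v₂)
    (hk : ContinuousOn k (Icc 0 1)) (hx : x ∈ Icc (0 : ℝ) 1) :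
    HasDerivWithinAt (S.greenSolution v₁ v₂ k)
      (dx v₂ x * (∫ y in (0 : ℝ)..x, S.r y * v₁ y * k y) +
        dx v₁ x * ∫ y in x..1, S.r y * v₂ y * k y) (Icc 0 1) x := by
  have h := hv.hasDerivWithinAt_mul_integral_add hk hx
    (hasDerivWithinAt_dx (hv.solvesODE₁.contDiffOn.differentiableOn two_ne_zero) hx)
    (hasDerivWithinAt_dx (hv.solvesODE₂.contDiffOn.differentiableOn two_ne_zero) hx)
  exact h.congr_deriv (by ring)

theorem contDiffOn_and_A_greenSolution_eqOn (hv : S.IsFundamental v₁ v₂)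
    (hk : ContinuousOn k (Icc 0 1)) :
    ContDiffOn ℝ 2 (S.greenSolution v₁ v₂ k) (Icc 0 1) ∧
      EqOn (S.A (S.greenSolution v₁ v₂ k)) k (Icc 0 1) := by
  refine contDiffOn_and_A_eqOn_of_hasDerivWithinAt
    (w := fun x => S.flux v₂ x * (∫ y in (0 : ℝ)..x, S.r y * v₁ y * k y) +
      S.flux v₁ x * ∫ y in x..1, S.r y * v₂ y * k y) (fun x hx => ?_) (fun x hx => ?_) hk
  · refine (hv.hasDerivWithinAt_greenSolution hk hx).congr_deriv ?_
    have hp := S.p_ne_zero hx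
    simp only [flux]
    field_simp
  · refine (hv.hasDerivWithinAt_mul_integral_add hk hx
      (hasDerivWithinAt_flux hv.solvesODE₁.contDiffOn hx)
      (hasDerivWithinAt_flux hv.solvesODE₂.contDiffOn hx)).congr_deriv ?_
    have hwronskian := hv.wronskian_eq x hx
    rw [wronskian] at hwronskian
    rw [hv.solvesODE₁.A_eq x hx, hv.solvesODE₂.A_eq x hx, greenSolution]
    linear_combination -(S.r x * k x) * hwronskian

theorem bc0_greenSolution (hv : S.IsFundamental v₁ v₂) (hk : ContinuousOn k (Icc 0 1)) :
    S.bc0 (S.greenSolution v₁ v₂ k) = 0 := by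
  have h0 : (0 : ℝ) ∈ Icc (0 : ℝ) 1 := left_mem_Icc.2 zero_le_one
  have hbc := hv.bc0_eq
  rw [bc0] at hbc ⊢
  rw [dx_eq_of_hasDerivWithinAt (hv.hasDerivWithinAt_greenSolution hk h0) h0, greenSolution,
    intervalIntegral.integral_same]
  linear_combination (∫ y in (0 : ℝ)..1, S.r y * v₂ y * k y) * hbc

theorem bc1_greenSolution (hv : S.IsFundamental v₁ v₂) (hk : ContinuousOn k (Icc 0 1)) :
    S.bc1 (S.greenSolution v₁ v₂ k) = 0 := by
  have h1 : (1 : ℝ) ∈ Icc (0 : ℝ) 1 := right_mem_Icc.2 zero_le_one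
  have hbc := hv.bc1_eq
  rw [bc1] at hbc ⊢
  rw [dx_eq_of_hasDerivWithinAt (hv.hasDerivWithinAt_greenSolution hk h1) h1, greenSolution,
    intervalIntegral.integral_same]
  linear_combination (∫ y in (0 : ℝ)..1, S.r y * v₁ y * k y) * hbc

theorem greenSolution_A_eqOn (hv : S.IsFundamental v₁ v₂) (h0 : ¬S.IsEigenvalue 0)
    (hg : ContDiffOn ℝ 2 g (Icc 0 1)) (hg0 : S.bc0 g = 0) (hg1 : S.bc1 g = 0) :
    EqOn (S.greenSolution v₁ v₂ (S.A g)) g (Icc 0 1) := by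
  have hk := continuousOn_A (S := S) hg
  obtain ⟨hC2, hA⟩ := hv.contDiffOn_and_A_greenSolution_eqOn hk
  exact eqOn_of_A_eqOn h0 hC2 hg ((hv.bc0_greenSolution hk).trans hg0.symm)
    ((hv.bc1_greenSolution hk).trans hg1.symm) hA

end IsFundamental

end SLData

/-! ### Integral operators with continuous kernel -/

section IntegralOperator

variable {𝕜 X H : Type*} [RCLike 𝕜] [TopologicalSpace X] [CompactSpace X] [NormedAddCommGroup H]
  [InnerProductSpace 𝕜 H]

/-- The operator `g ↦ (x ↦ ⟪K x, g⟫)` from an inner product space to continuous functions. -/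
noncomputable def innerOperator (K : C(X, H)) : H →L[𝕜] BoundedContinuousFunction X 𝕜 :=
  LinearMap.mkContinuous
    { toFun := fun g => BoundedContinuousFunction.mkOfCompact
        ⟨fun x => inner 𝕜 (K x) g, K.continuous.inner continuous_const⟩
      map_add' := fun g h => by ext x; simp [inner_add_right]
      map_smul' := fun c g => by ext x; simp [inner_smul_right] } ‖K‖ fun g =>
    (BoundedContinuousFunction.norm_le (by positivity)).2 fun x =>
      (norm_inner_le_norm _ _).trans
        (mul_le_mul_of_nonneg_right (K.norm_coe_le_norm x) (norm_nonneg _))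

theorem innerOperator_apply (K : C(X, H)) (g : H) (x : X) :
    innerOperator (𝕜 := 𝕜) K g x = inner 𝕜 (K x) g := rfl

/-- The image of the unit ball is equicontinuous because `K` is continuous into `H`. -/
theorem isCompactOperator_innerOperator (K : C(X, H)) :
    IsCompactOperator (innerOperator (𝕜 := 𝕜) K) := by
  rw [isCompactOperator_iff_exists_mem_nhds_isCompact_closure_image]
  refine ⟨Metric.ball 0 1, Metric.ball_mem_nhds _ one_pos, ?_⟩
  refine BoundedContinuousFunction.arzela_ascoli (Metric.closedBall 0 ‖K‖)
    (isCompact_closedBall 0 ‖K‖) _ ?_ fun x₀ => ?_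
  · rintro _ x ⟨g, hg, rfl⟩
    rw [mem_ball_zero_iff] at hg
    rw [mem_closedBall_zero_iff, innerOperator_apply]
    calc ‖inner 𝕜 (K x) g‖ ≤ ‖K x‖ * ‖g‖ := norm_inner_le_norm _ _
      _ ≤ ‖K‖ * 1 := mul_le_mul (K.norm_coe_le_norm x) hg.le (norm_nonneg _) (norm_nonneg _)
      _ = ‖K‖ := mul_one _
  · refine Metric.equicontinuousAt_of_continuity_modulus (fun x => ‖K x₀ - K x‖) ?_ _ ?_
    · have h : Tendsto (fun x => ‖K x₀ - K x‖) (𝓝 x₀) (𝓝 ‖K x₀ - K x₀‖) :=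
        (continuous_const.sub K.continuous).norm.tendsto x₀
      rwa [sub_self, norm_zero] at h
    · filter_upwards with x
      rintro ⟨_, g, hg, rfl⟩
      rw [mem_ball_zero_iff] at hg
      rw [dist_eq_norm, innerOperator_apply, innerOperator_apply, ← inner_sub_left]
      exact (norm_inner_le_norm _ _).trans (mul_le_of_le_one_right (norm_nonneg _) hg.le)

variable [MeasurableSpace X] [BorelSpace X] (m : Measure X) [IsFiniteMeasure m]

/-- The integral operator with kernel `k`, mapping `L²` to continuous functions. -/
noncomputable def kernelMap (k : C(X × X, ℝ)) : Lp ℝ 2 m →L[ℝ] BoundedContinuousFunction X ℝ :=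
  innerOperator ⟨fun x => ContinuousMap.toLp (E := ℝ) 2 m ℝ (k.curry x),
    (ContinuousLinearMap.continuous _).comp k.curry.continuous⟩

/-- The integral operator with kernel `k` on `L²`. -/
noncomputable def kernelOperator (k : C(X × X, ℝ)) : Lp ℝ 2 m →L[ℝ] Lp ℝ 2 m :=
  (BoundedContinuousFunction.toLp (E := ℝ) 2 m ℝ).comp (kernelMap m k)

theorem isCompactOperator_kernelOperator (k : C(X × X, ℝ)) :
    IsCompactOperator (kernelOperator m k) :=
  IsCompactOperator.clm_comp (f := kernelMap m k) (isCompactOperator_innerOperator _)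
    (BoundedContinuousFunction.toLp 2 m ℝ)

variable {m}

theorem kernelMap_apply (k : C(X × X, ℝ)) (g : Lp ℝ 2 m) (x : X) :
    kernelMap m k g x = ∫ y, k (x, y) * g y ∂m := by
  rw [kernelMap, innerOperator_apply, L2.inner_def]
  refine integral_congr_ae ?_
  filter_upwards [ContinuousMap.coeFn_toLp (p := 2) (𝕜 := ℝ) m (k.curry x)] with y hy
  rw [RCLike.inner_apply, conj_trivial, mul_comm, ContinuousMap.coe_mk, hy]
  rfl

theorem coeFn_kernelOperator (k : C(X × X, ℝ)) (g : Lp ℝ 2 m) :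
    kernelOperator m k g =ᵐ[m] kernelMap m k g :=
  BoundedContinuousFunction.coeFn_toLp (p := 2) (𝕜 := ℝ) m (kernelMap m k g)

theorem isSymmetric_kernelOperator [SecondCountableTopology X] {k : C(X × X, ℝ)}
    (hk : ∀ x y, k (x, y) = k (y, x)) : (kernelOperator m k).IsSymmetric := fun f g => by
  have hleft : inner ℝ (kernelOperator m k f) g = ∫ x, ∫ y, k (x, y) * (f y * g x) ∂m ∂m := by
    rw [L2.inner_def]
    refine integral_congr_ae ?_
    filter_upwards [coeFn_kernelOperator k f] with x hx
    rw [RCLike.inner_apply, conj_trivial, hx, kernelMap_apply, ← integral_const_mul]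
    exact integral_congr_ae (.of_forall fun y => by ring)
  have hright : inner ℝ f (kernelOperator m k g) = ∫ y, ∫ x, k (x, y) * (f y * g x) ∂m ∂m := by
    rw [L2.inner_def]
    refine integral_congr_ae ?_
    filter_upwards [coeFn_kernelOperator k g] with y hy
    rw [RCLike.inner_apply, conj_trivial, hy, kernelMap_apply, ← integral_mul_const]
    exact integral_congr_ae (.of_forall fun x => by simp only [hk y x]; ring)
  have hfg : Integrable (fun z : X × X => f z.2 * g z.1) (m.prod m) :=
    (((Lp.memLp g).integrable one_le_two).mul_prod ((Lp.memLp f).integrable one_le_two)).congr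
      (.of_forall fun z => mul_comm _ _)
  exact hleft.trans ((integral_integral_swap (hfg.bdd_mul k.continuous.aestronglyMeasurable
    (.of_forall fun z => k.norm_coe_le_norm z))).trans hright.symm)

end IntegralOperator

/-! ### The space `L²_r(0,1)` and the inverse of the Sturm-Liouville operator -/

theorem integral_unitInterval (F : ℝ → ℝ) : ∫ x : unitInterval, F x = ∫ x in (0 : ℝ)..1, F x := by
  rw [intervalIntegral.integral_of_le zero_le_one, ← integral_Icc_eq_integral_Ioc]
  exact integral_subtype_comap measurableSet_Icc F

theorem integrable_unitInterval_iff {F : ℝ → ℝ} :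
    Integrable (fun x : unitInterval => F x) ↔ IntervalIntegrable F volume 0 1 := by
  rw [intervalIntegrable_iff_integrableOn_Icc_of_le zero_le_one]
  exact unitInterval.measurePreserving_coe.integrable_comp_emb
    (MeasurableEmbedding.subtype_coe measurableSet_Icc)

namespace SLData

variable {S : SLData} {g h : ℝ → ℝ}

theorem continuous_r_coe (S : SLData) : Continuous fun x : unitInterval => S.r x :=
  continuousOn_iff_continuous_domRestrict.1 S.r_continuousOn

/-- The measure `r(x) dx` on `[0,1]`, so that `L²_r(0,1)` is the `L²` space of this measure. -/
noncomputable def weightedMeasure (S : SLData) : Measure unitInterval :=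
  volume.withDensity fun x => ENNReal.ofReal (S.r x)

instance isFiniteMeasure_weightedMeasure (S : SLData) : IsFiniteMeasure S.weightedMeasure :=
  isFiniteMeasure_withDensity_ofReal (BoundedContinuousFunction.integrable volume
    (BoundedContinuousFunction.mkOfCompact ⟨_, S.continuous_r_coe⟩)).2

theorem integral_weightedMeasure (S : SLData) (F : unitInterval → ℝ) :
    ∫ x, F x ∂S.weightedMeasure = ∫ x : unitInterval, S.r x * F x := by
  rw [weightedMeasure, integral_withDensity_eq_integral_toReal_smul
    S.continuous_r_coe.measurable.ennreal_ofReal (.of_forall fun _ => ENNReal.ofReal_lt_top)]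
  simp only [ENNReal.toReal_ofReal (S.r_pos _ (Subtype.prop _)).le, smul_eq_mul]

theorem integrable_weightedMeasure_iff {F : unitInterval → ℝ} :
    Integrable F S.weightedMeasure ↔ Integrable fun x : unitInterval => S.r x * F x := by
  rw [weightedMeasure, integrable_withDensity_iff_integrable_smul'
    S.continuous_r_coe.measurable.ennreal_ofReal (.of_forall fun _ => ENNReal.ofReal_lt_top)]
  simp only [ENNReal.toReal_ofReal (S.r_pos _ (Subtype.prop _)).le, smul_eq_mul]

theorem weightedMeasure_absolutelyContinuous (S : SLData) : S.weightedMeasure ≪ volume :=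
  withDensity_absolutelyContinuous _ _

theorem MemL2.memLp (hg : S.MemL2 g) :
    MemLp (fun x : unitInterval => g x) 2 S.weightedMeasure := by
  have hmeas : AEStronglyMeasurable g (volume.restrict (Icc 0 1)) :=
    restrict_Ioc_eq_restrict_Icc (μ := volume) (a := (0 : ℝ)) (b := 1) ▸ hg.1
  have hmeas_coe : AEStronglyMeasurable (fun x : unitInterval => g x) S.weightedMeasure :=
    (hmeas.comp_measurePreserving unitInterval.measurePreserving_coe).mono_ac
      S.weightedMeasure_absolutelyContinuous
  rw [memLp_two_iff_integrable_sq hmeas_coe]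
  exact integrable_weightedMeasure_iff.2 (integrable_unitInterval_iff.2 hg.2)

theorem memL2_of_continuousOn (hg : ContinuousOn g (Icc 0 1)) : S.MemL2 g :=
  ⟨(hg.mono Ioc_subset_Icc_self).aestronglyMeasurable measurableSet_Ioc,
    (S.r_continuousOn.mul (hg.pow 2)).intervalIntegrable_of_Icc zero_le_one⟩

/-- The element of the Hilbert space `L²_r(0,1)` represented by `g`. -/
noncomputable def toL2 (hg : S.MemL2 g) : Lp ℝ 2 S.weightedMeasure := hg.memLp.toLp _

theorem coeFn_toL2 (hg : S.MemL2 g) :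
    toL2 hg =ᵐ[S.weightedMeasure] fun x : unitInterval => g x :=
  MemLp.coeFn_toLp _

theorem toL2_eq_smul (hg : S.MemL2 g) (hh : S.MemL2 h) {c : ℝ}
    (hgh : EqOn h (fun x => c * g x) (Icc 0 1)) : toL2 hh = c • toL2 hg := by
  rw [toL2, toL2, ← MemLp.toLp_const_smul, MemLp.toLp_eq_toLp_iff]
  exact .of_forall fun x => hgh x.2

theorem inner_toL2 (hg : S.MemL2 g) (hh : S.MemL2 h) :
    inner ℝ (toL2 hg) (toL2 hh) = S.wInner g h := by
  rw [wInner, ← integral_unitInterval, L2.inner_def]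
  simp only [mul_assoc]
  rw [← S.integral_weightedMeasure fun x => g x * h x]
  refine integral_congr_ae ?_
  filter_upwards [coeFn_toL2 hg, coeFn_toL2 hh] with x hgx hhx
  rw [RCLike.inner_apply, conj_trivial, hgx, hhx, mul_comm]

theorem norm_toL2 (hg : S.MemL2 g) : ‖toL2 hg‖ = S.norm g := by
  simp only [norm_eq_sqrt_real_inner, inner_toL2, SLData.norm, wInner, sq, mul_assoc]

namespace IsFundamental

variable {v₁ v₂ : ℝ → ℝ}

/-- Green's kernel of `A` with its homogeneous boundary conditions. -/
noncomputable def kernel (hv : S.IsFundamental v₁ v₂) : C(unitInterval × unitInterval, ℝ) where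
  toFun z := v₁ (min z.1 z.2 : unitInterval) * v₂ (max z.1 z.2 : unitInterval)
  continuous_toFun :=
    ((continuousOn_iff_continuous_domRestrict.1 hv.solvesODE₁.contDiffOn.continuousOn).comp
      (continuous_fst.min continuous_snd)).mul
    ((continuousOn_iff_continuous_domRestrict.1 hv.solvesODE₂.contDiffOn.continuousOn).comp
      (continuous_fst.max continuous_snd))

theorem kernel_symm (hv : S.IsFundamental v₁ v₂) (x y : unitInterval) :
    hv.kernel (x, y) = hv.kernel (y, x) := by
  change v₁ (min x y : unitInterval) * v₂ (max x y : unitInterval) = _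
  rw [min_comm, max_comm]
  rfl

theorem kernelMap_toL2 (hv : S.IsFundamental v₁ v₂) (hg : ContinuousOn g (Icc 0 1))
    (x : unitInterval) : kernelMap S.weightedMeasure hv.kernel (toL2 (memL2_of_continuousOn hg)) x =
      S.greenSolution v₁ v₂ g x := by
  have h₁ : ContinuousOn (fun y => S.r y * v₁ y * g y) (Icc 0 1) :=
    (S.r_continuousOn.mul hv.solvesODE₁.contDiffOn.continuousOn).mul hg
  have h₂ : ContinuousOn (fun y => S.r y * v₂ y * g y) (Icc 0 1) :=
    (S.r_continuousOn.mul hv.solvesODE₂.contDiffOn.continuousOn).mul hg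
  let P : ℝ → ℝ := fun y => S.r y * (v₁ (min (x : ℝ) y) * v₂ (max (x : ℝ) y) * g y)
  have hP₁ : EqOn P (fun y => v₂ x * (S.r y * v₁ y * g y)) (uIcc 0 x) := fun y hy => by
    rw [uIcc_of_le x.2.1] at hy
    simp only [P, min_eq_right hy.2, max_eq_left hy.2]
    ring
  have hP₂ : EqOn P (fun y => v₁ x * (S.r y * v₂ y * g y)) (uIcc x 1) := fun y hy => by
    rw [uIcc_of_le x.2.2] at hy
    simp only [P, min_eq_left hy.1, max_eq_right hy.1]
    ring
  have hkernel : kernelMap S.weightedMeasure hv.kernel (toL2 (memL2_of_continuousOn hg)) x =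
      ∫ y in (0 : ℝ)..1, P y := by
    rw [kernelMap_apply, ← integral_unitInterval P]
    refine (integral_congr_ae ?_).trans (S.integral_weightedMeasure _)
    filter_upwards [coeFn_toL2 (memL2_of_continuousOn (S := S) hg)] with y hy
    rw [hy]
    rfl
  rw [hkernel, ← intervalIntegral.integral_add_adjacent_intervals (b := (x : ℝ))
    ((((h₁.mono (Icc_subset_Icc_right x.2.2)).intervalIntegrable_of_Icc x.2.1).const_mul _).congr
      fun y hy => (hP₁ (uIoc_subset_uIcc hy)).symm)
    ((((h₂.mono (Icc_subset_Icc_left x.2.1)).intervalIntegrable_of_Icc x.2.2).const_mul _).congr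
      fun y hy => (hP₂ (uIoc_subset_uIcc hy)).symm),
    intervalIntegral.integral_congr hP₁, intervalIntegral.integral_congr hP₂,
    intervalIntegral.integral_const_mul, intervalIntegral.integral_const_mul, greenSolution]

theorem kernelOperator_toL2 (hv : S.IsFundamental v₁ v₂) (hg : ContinuousOn g (Icc 0 1))
    (hh : S.MemL2 h) (hgh : EqOn (S.greenSolution v₁ v₂ g) h (Icc 0 1)) :
    kernelOperator S.weightedMeasure hv.kernel (toL2 (memL2_of_continuousOn hg)) = toL2 hh := by
  refine Lp.ext ((coeFn_kernelOperator _ _).trans (.trans (.of_eq (funext fun x => ?_))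
    (coeFn_toL2 hh).symm))
  rw [hv.kernelMap_toL2 hg, hgh x.2]

end IsFundamental

end SLData

/-! ### Completeness of the eigenfunctions -/

theorem dx_eq_zero_of_notMem_tsupport {ψ : ℝ → ℝ} {x : ℝ} (hx : x ∈ Icc (0 : ℝ) 1)
    (hψ : x ∉ tsupport ψ) : dx ψ x = 0 :=
  dx_eq_of_hasDerivWithinAt ((hasDerivAt_const x (0 : ℝ)).congr_of_eventuallyEq
    (notMem_tsupport_iff_eventuallyEq.1 hψ)).hasDerivWithinAt hx

namespace SLData

variable {S : SLData} {g : ℝ → ℝ}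

theorem bc0_eq_zero_of_tsupport_subset {ψ : ℝ → ℝ} (hψ : tsupport ψ ⊆ Ioo 0 1) :
    S.bc0 ψ = 0 := by
  have h : (0 : ℝ) ∉ tsupport ψ := fun h => (hψ h).1.false
  rw [bc0, image_eq_zero_of_notMem_tsupport h,
    dx_eq_zero_of_notMem_tsupport (left_mem_Icc.2 zero_le_one) h]
  ring

theorem bc1_eq_zero_of_tsupport_subset {ψ : ℝ → ℝ} (hψ : tsupport ψ ⊆ Ioo 0 1) :
    S.bc1 ψ = 0 := by
  have h : (1 : ℝ) ∉ tsupport ψ := fun h => (hψ h).2.false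
  rw [bc1, image_eq_zero_of_notMem_tsupport h,
    dx_eq_zero_of_notMem_tsupport (right_mem_Icc.2 zero_le_one) h]
  ring

theorem inner_toL2_left (hg : S.MemL2 g) (G : Lp ℝ 2 S.weightedMeasure) :
    inner ℝ (toL2 hg) G = ∫ x : unitInterval, S.r x * (g x * G x) := by
  rw [L2.inner_def, ← S.integral_weightedMeasure]
  refine integral_congr_ae ?_
  filter_upwards [coeFn_toL2 hg] with x hx
  rw [RCLike.inner_apply, conj_trivial, hx, mul_comm]

open scoped ContDiff in
theorem eq_zero_of_inner_toL2_eq_zero {G : Lp ℝ 2 S.weightedMeasure}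
    (hG : ∀ (ψ : ℝ → ℝ) (hψ : ContDiff ℝ ∞ ψ), tsupport ψ ⊆ Ioo 0 1 →
      inner ℝ (toL2 (memL2_of_continuousOn hψ.continuous.continuousOn)) G = 0) : G = 0 := by
  let E : ℝ → ℝ := Function.extend Subtype.val G 0
  have hE (x : unitInterval) : E x = G x := Subtype.val_injective.extend_apply _ _ x
  have hint : IntegrableOn (fun x => S.r x * E x) (Icc 0 1) := by
    rw [← intervalIntegrable_iff_integrableOn_Icc_of_le zero_le_one,
      ← integrable_unitInterval_iff]
    simp only [hE]
    exact integrable_weightedMeasure_iff.1 ((Lp.memLp G).integrable one_le_two)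
  have hrE : ∀ᵐ x, x ∈ Ioo (0 : ℝ) 1 → S.r x * E x = 0 := by
    refine isOpen_Ioo.ae_eq_zero_of_integral_contDiff_smul_eq_zero
      (hint.mono_set Ioo_subset_Icc_self).locallyIntegrableOn fun ψ hψ _ hsupp => ?_
    have hvanish : ∀ x ∉ Ioc (0 : ℝ) 1, ψ x • (S.r x * E x) = 0 := fun x hx => by
      rw [image_eq_zero_of_notMem_tsupport fun h => hx (Ioo_subset_Ioc_self (hsupp h)), zero_smul]
    rw [← setIntegral_eq_integral_of_forall_compl_eq_zero hvanish,
      ← intervalIntegral.integral_of_le zero_le_one, ← integral_unitInterval, ← hG ψ hψ hsupp,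
      inner_toL2_left]
    exact integral_congr_ae (.of_forall fun x => by simp only [hE, smul_eq_mul]; ring)
  have hE0 : ∀ᵐ x ∂volume.restrict (Icc (0 : ℝ) 1), E x = 0 := by
    rw [← restrict_Ioo_eq_restrict_Icc, ae_restrict_iff' measurableSet_Ioo]
    filter_upwards [hrE] with x hx hmem
    exact (mul_eq_zero.1 (hx hmem)).resolve_left (S.r_ne_zero (Ioo_subset_Icc_self hmem))
  refine (Lp.eq_zero_iff_ae_eq_zero).2 (S.weightedMeasure_absolutelyContinuous.ae_le ?_)
  filter_upwards [unitInterval.measurePreserving_coe.quasiMeasurePreserving.ae hE0] with x hx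
  rw [← hE, hx, Pi.zero_apply]

namespace IsFundamental

variable {v₁ v₂ : ℝ → ℝ} {G : Lp ℝ 2 S.weightedMeasure}

/-- Every test function `ψ` lies in the range of the kernel operator, being the image of `A ψ`. -/
theorem eq_zero_of_kernelOperator_eq_zero (hv : S.IsFundamental v₁ v₂) (h0 : ¬S.IsEigenvalue 0)
    (hG : kernelOperator S.weightedMeasure hv.kernel G = 0) : G = 0 := by
  refine eq_zero_of_inner_toL2_eq_zero fun ψ hψ hsupp => ?_
  have hψ₂ : ContDiffOn ℝ 2 ψ (Icc 0 1) := (contDiff_infty.1 hψ 2).contDiffOn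
  have hrange := hv.kernelOperator_toL2 (continuousOn_A hψ₂)
    (memL2_of_continuousOn hψ.continuous.continuousOn) (hv.greenSolution_A_eqOn h0 hψ₂
      (bc0_eq_zero_of_tsupport_subset hsupp) (bc1_eq_zero_of_tsupport_subset hsupp))
  rw [← hrange]
  exact (isSymmetric_kernelOperator hv.kernel_symm _ G).trans
    (by rw [ContinuousLinearMap.coe_coe, hG, inner_zero_right])

theorem exists_solvesODE_of_kernelOperator_eq_smul (hv : S.IsFundamental v₁ v₂) {μ : ℝ}
    (hμ : μ ≠ 0) (hG : kernelOperator S.weightedMeasure hv.kernel G = μ • G) :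
    ∃ (y : ℝ → ℝ) (hy : S.SolvesODE μ⁻¹ y), S.bc0 y = 0 ∧ S.bc1 y = 0 ∧
      μ • G = toL2 (memL2_of_continuousOn hy.contDiffOn.continuousOn) := by
  let κ := kernelMap S.weightedMeasure hv.kernel G
  let g : ℝ → ℝ := IccExtend zero_le_one fun x : unitInterval => μ⁻¹ * κ x
  have hgκ (x : unitInterval) : g x = μ⁻¹ * κ x := IccExtend_val _ _ x
  have hg : ContinuousOn g (Icc 0 1) :=
    (Continuous.Icc_extend' (continuous_const.mul κ.continuous)).continuousOn
  have hGg : G = toL2 (memL2_of_continuousOn hg) := by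
    refine Lp.ext (.trans ?_ (coeFn_toL2 (memL2_of_continuousOn hg)).symm)
    filter_upwards [Lp.coeFn_smul μ G, hG ▸ coeFn_kernelOperator hv.kernel G] with x hsmul hκ
    rw [hgκ, ← hκ, hsmul, Pi.smul_apply, smul_eq_mul, inv_mul_cancel_left₀ hμ]
  have hκ (x : unitInterval) : κ x = S.greenSolution v₁ v₂ g x := by
    simp only [κ, hGg, hv.kernelMap_toL2 hg]
  obtain ⟨hy, hAy⟩ := hv.contDiffOn_and_A_greenSolution_eqOn hg
  refine ⟨S.greenSolution v₁ v₂ g, ⟨hy, fun x hx => ?_⟩, hv.bc0_greenSolution hg,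
    hv.bc1_greenSolution hg, ?_⟩
  · rw [hAy hx, hgκ ⟨x, hx⟩, hκ]
  · rw [← hG, hGg]
    exact hv.kernelOperator_toL2 hg _ fun x _ => rfl

end IsFundamental

namespace SolvesODE

variable {μ : ℝ} {y : ℝ → ℝ}

theorem wInner_A_left (hy : S.SolvesODE μ y) (g : ℝ → ℝ) :
    S.wInner (S.A y) g = μ * S.wInner y g := by
  rw [wInner, wInner, ← intervalIntegral.integral_const_mul]
  refine intervalIntegral.integral_congr fun x hx => ?_
  rw [uIcc_of_le zero_le_one] at hx
  simp only [hy.A_eq x hx]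
  ring

theorem wInner_A (hy : S.SolvesODE μ y) (hy0 : S.bc0 y = 0) (hy1 : S.bc1 y = 0)
    (hg : ContDiffOn ℝ 2 g (Icc 0 1)) :
    S.wInner y (S.A g) = μ * S.wInner y g - S.trace₀ y * S.bc0 g - S.trace₁ y * S.bc1 g := by
  rw [SLData.wInner_A hy.contDiffOn hy0 hy1 hg, hy.wInner_A_left]

end SolvesODE

namespace IsEigensystem

variable {lam : ℕ → ℝ} {φ : ℕ → ℝ → ℝ}

theorem lam_pos (hsys : S.IsEigensystem lam φ) (hpos : 0 < lam 0) (n : ℕ) : 0 < lam n :=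
  hpos.trans_le (hsys.strictMono.monotone n.zero_le)

theorem not_isEigenvalue_zero (hsys : S.IsEigensystem lam φ) (hpos : 0 < lam 0) :
    ¬S.IsEigenvalue 0 := fun h => by
  obtain ⟨n, hn⟩ := (hsys.isEigenvalue_iff 0).1 h
  exact (hsys.lam_pos hpos n).ne' hn

theorem solvesODE (hsys : S.IsEigensystem lam φ) (n : ℕ) : S.SolvesODE (lam n) (φ n) where
  contDiffOn := hsys.contDiffOn n
  A_eq := EqOn.of_subset_closure (s := Ioo 0 1) (hsys.eigen n) (continuousOn_A (hsys.contDiffOn n))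
    (continuousOn_const.mul (hsys.contDiffOn n).continuousOn) Ioo_subset_Icc_self
    (closure_Ioo zero_ne_one).ge

theorem memL2 (hsys : S.IsEigensystem lam φ) (n : ℕ) : S.MemL2 (φ n) :=
  memL2_of_continuousOn (hsys.contDiffOn n).continuousOn

theorem exists_ne_zero (hsys : S.IsEigensystem lam φ) (n : ℕ) :
    ∃ x ∈ Icc (0 : ℝ) 1, φ n x ≠ 0 := by
  by_contra! hzero
  have hint : ∫ x in (0 : ℝ)..1, S.r x * φ n x ^ 2 = ∫ _ in (0 : ℝ)..1, (0 : ℝ) :=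
    intervalIntegral.integral_congr fun x hx => by
      rw [uIcc_of_le zero_le_one] at hx
      simp only [hzero x hx, zero_pow two_ne_zero, mul_zero]
  have hnorm := hsys.normalized n
  rw [SLData.norm, hint, intervalIntegral.integral_zero, Real.sqrt_zero] at hnorm
  exact zero_ne_one hnorm

theorem wInner_A (hsys : S.IsEigensystem lam φ) (n : ℕ) (hg : ContDiffOn ℝ 2 g (Icc 0 1)) :
    S.wInner (φ n) (S.A g) =
      lam n * S.wInner (φ n) g - S.trace₀ (φ n) * S.bc0 g - S.trace₁ (φ n) * S.bc1 g :=
  (hsys.solvesODE n).wInner_A (hsys.inDomain n).2.1 (hsys.inDomain n).2.2 hg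

theorem orthonormal (hsys : S.IsEigensystem lam φ) :
    Orthonormal ℝ fun n => toL2 (hsys.memL2 n) := by
  refine ⟨fun n => by rw [norm_toL2, hsys.normalized n], fun m n hmn => ?_⟩
  have h := hsys.wInner_A m (hsys.contDiffOn n)
  rw [(hsys.inDomain n).2.1, (hsys.inDomain n).2.2, wInner_comm, (hsys.solvesODE n).wInner_A_left,
    wInner_comm] at h
  have hne : lam n - lam m ≠ 0 := sub_ne_zero.2 (hsys.strictMono.injective.ne hmn.symm)
  simp only [inner_toL2]
  refine (mul_eq_zero.1 ?_).resolve_left hne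
  linear_combination h

theorem mem_span_of_kernelOperator_eq_smul (hsys : S.IsEigensystem lam φ) {v₁ v₂ : ℝ → ℝ}
    (hv : S.IsFundamental v₁ v₂) {μ : ℝ} (hμ : μ ≠ 0) {G : Lp ℝ 2 S.weightedMeasure}
    (hG : kernelOperator S.weightedMeasure hv.kernel G = μ • G) :
    G ∈ Submodule.span ℝ (range fun n => toL2 (hsys.memL2 n)) := by
  obtain ⟨y, hy, hy0, hy1, hGy⟩ := hv.exists_solvesODE_of_kernelOperator_eq_smul hμ hG
  rw [← Submodule.smul_mem_iff _ hμ, hGy]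
  by_cases hne : ∃ x ∈ Icc (0 : ℝ) 1, y x ≠ 0
  · obtain ⟨n, hn⟩ := (hsys.isEigenvalue_iff _).1 (hy.isEigenvalue hy0 hy1 hne)
    obtain ⟨c, hc⟩ := hy.eqOn_const_mul_of_bc0 (hn ▸ hsys.solvesODE n) hy0 (hsys.inDomain n).2.1
      (hsys.exists_ne_zero n)
    rw [toL2_eq_smul (hsys.memL2 n) _ hc]
    exact Submodule.smul_mem _ _ (Submodule.subset_span ⟨n, rfl⟩)
  · push Not at hne
    rw [toL2_eq_smul (hsys.memL2 0) _ (c := 0) fun x hx => (hne x hx).trans (zero_mul _).symm,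
      zero_smul]
    exact Submodule.zero_mem _

theorem span_orthogonal_eq_bot (hsys : S.IsEigensystem lam φ) (h0 : ¬S.IsEigenvalue 0) :
    (Submodule.span ℝ (range fun n => toL2 (hsys.memL2 n)))ᗮ = ⊥ := by
  obtain ⟨v₁, v₂, hv⟩ := exists_isFundamental h0
  rw [eq_bot_iff, ← ContinuousLinearMap.orthogonalComplement_iSup_eigenspaces_eq_bot
    (isCompactOperator_kernelOperator S.weightedMeasure hv.kernel)
    (isSymmetric_kernelOperator hv.kernel_symm)]
  refine Submodule.orthogonal_le (iSup_le fun μ G hG => ?_)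
  have heigen : kernelOperator S.weightedMeasure hv.kernel G = μ • G :=
    Module.End.mem_eigenspace_iff.1 hG
  rcases eq_or_ne μ 0 with rfl | hμ
  · rw [hv.eq_zero_of_kernelOperator_eq_zero h0 (heigen.trans (zero_smul _ _))]
    exact Submodule.zero_mem _
  · exact hsys.mem_span_of_kernelOperator_eq_smul hv hμ heigen

theorem hasSum_wInner_sq (hsys : S.IsEigensystem lam φ) (h0 : ¬S.IsEigenvalue 0)
    (hg : S.MemL2 g) : HasSum (fun n => S.wInner (φ n) g ^ 2) (S.norm g ^ 2) := by
  have h := (HilbertBasis.mkOfOrthogonalEqBot hsys.orthonormal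
    (hsys.span_orthogonal_eq_bot h0)).hasSum_inner_mul_inner (toL2 hg) (toL2 hg)
  rw [HilbertBasis.coe_mkOfOrthogonalEqBot, real_inner_self_eq_norm_sq, norm_toL2] at h
  refine h.congr_fun fun n => ?_
  rw [real_inner_comm, inner_toL2, sq]

end IsEigensystem

end SLData

/-! ### Stationary problems and the gains -/

namespace SLData

variable {S : SLData} {β β₀ β₁ : ℝ} {v : ℝ → ℝ}

theorem solvesBVP_iff : S.SolvesBVP β₀ β₁ v ↔
    S.SolvesODE 0 v ∧ S.bc0 v = β₀ ∧ S.bc1 v = β₁ := by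
  have hA : ∀ x ∈ Icc (0 : ℝ) 1,
      (dx (fun y => S.p y * dx v y) x - S.q x * v x = 0 ↔ S.A v x = 0 * v x) := fun x hx => by
    have hr := S.r_ne_zero hx
    rw [A, zero_mul, ← neg_eq_zero, ← mul_right_inj' (inv_ne_zero hr), mul_zero]
    refine iff_of_eq (congrArg (· = 0) ?_)
    field_simp
    ring
  constructor
  · rintro ⟨hv, hode, h0, h1⟩
    exact ⟨⟨hv, fun x hx => (hA x hx).1 (hode x hx)⟩, h0, h1⟩
  · rintro ⟨hv, h0, h1⟩
    exact ⟨hv.contDiffOn, fun x hx => (hA x hx).2 (hv.A_eq x hx), h0, h1⟩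

namespace IsFundamental

variable {v₁ v₂ : ℝ → ℝ}

theorem trace₀_mul_bc0 (hv : S.IsFundamental v₁ v₂) : S.trace₀ v₁ * S.bc0 v₂ = 1 := by
  rw [← wronskian_zero_eq v₂ hv.bc0_eq, hv.wronskian_eq 0 (left_mem_Icc.2 zero_le_one)]

theorem trace₁_mul_bc1 (hv : S.IsFundamental v₁ v₂) : S.trace₁ v₂ * S.bc1 v₁ = 1 := by
  have h := wronskian_one_eq v₁ hv.bc1_eq
  have hW := hv.wronskian_eq 1 (right_mem_Icc.2 zero_le_one)
  rw [wronskian] at h hW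
  linarith

theorem solvesBVP (hv : S.IsFundamental v₁ v₂) (β₀ β₁ : ℝ) :
    S.SolvesBVP β₀ β₁ fun x => β₁ * S.trace₁ v₂ * v₁ x + β₀ * S.trace₀ v₁ * v₂ x := by
  have hv₁ := hv.solvesODE₁.contDiffOn.differentiableOn two_ne_zero
  have hv₂ := hv.solvesODE₂.contDiffOn.differentiableOn two_ne_zero
  refine solvesBVP_iff.2 ⟨hv.solvesODE₁.linearCombination hv.solvesODE₂ _ _, ?_, ?_⟩
  · rw [bc0_linearCombination hv₁ hv₂, hv.bc0_eq]
    linear_combination β₀ * hv.trace₀_mul_bc0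
  · rw [bc1_linearCombination hv₁ hv₂, hv.bc1_eq]
    linear_combination β₁ * hv.trace₁_mul_bc1

end IsFundamental

theorem exists_isUniqueBVPSolution (h0 : ¬S.IsEigenvalue 0) (β₀ β₁ : ℝ) :
    ∃ v, S.IsUniqueBVPSolution β₀ β₁ v := by
  obtain ⟨v₁, v₂, hv⟩ := exists_isFundamental h0
  refine ⟨_, hv.solvesBVP β₀ β₁, fun w hw => ?_⟩
  obtain ⟨hv, hv0, hv1⟩ := solvesBVP_iff.1 (hv.solvesBVP β₀ β₁)
  obtain ⟨hw, hw0, hw1⟩ := solvesBVP_iff.1 hw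
  exact eqOn_of_A_eqOn h0 hw.contDiffOn hv.contDiffOn (hw0.trans hv0.symm) (hw1.trans hv1.symm)
    fun x hx => by rw [hw.A_eq x hx, hv.A_eq x hx, zero_mul, zero_mul]

theorem norm_nonneg (g : ℝ → ℝ) : 0 ≤ S.norm g := Real.sqrt_nonneg _

theorem gainTerm₀_eq (S : SLData) (lam : ℕ → ℝ) (φ : ℕ → ℝ → ℝ) :
    S.gainTerm₀ lam φ =
      fun n => ((S.b₁ ^ 2 + S.b₂ ^ 2) / S.p 0) ^ 2 * (S.trace₀ (φ n) / lam n) ^ 2 := by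
  funext n
  have hp := S.p_ne_zero (left_mem_Icc.2 zero_le_one)
  have hb := S.b_sq_pos.ne'
  rw [gainTerm₀, trace₀, sq_abs]
  field_simp

theorem gainTerm₁_eq (S : SLData) (lam : ℕ → ℝ) (φ : ℕ → ℝ → ℝ) :
    S.gainTerm₁ lam φ =
      fun n => ((S.a₁ ^ 2 + S.a₂ ^ 2) / S.p 1) ^ 2 * (S.trace₁ (φ n) / lam n) ^ 2 := by
  funext n
  have hp := S.p_ne_zero (right_mem_Icc.2 zero_le_one)
  have ha := S.a_sq_pos.ne'
  rw [gainTerm₁, trace₁, sq_abs]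
  field_simp

theorem C₀_eq_sqrt_tsum (S : SLData) (lam : ℕ → ℝ) (φ : ℕ → ℝ → ℝ) :
    S.C₀ lam φ = √(∑' n, (S.trace₀ (φ n) / lam n) ^ 2) := by
  have hp := S.p_pos 0 (left_mem_Icc.2 zero_le_one)
  have hb := S.b_sq_pos
  rw [C₀, gainTerm₀_eq, tsum_mul_left, Real.sqrt_mul (sq_nonneg _), Real.sqrt_sq (by positivity)]
  field_simp

theorem C₁_eq_sqrt_tsum (S : SLData) (lam : ℕ → ℝ) (φ : ℕ → ℝ → ℝ) :
    S.C₁ lam φ = √(∑' n, (S.trace₁ (φ n) / lam n) ^ 2) := by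
  have hp := S.p_pos 1 (right_mem_Icc.2 zero_le_one)
  have ha := S.a_sq_pos
  rw [C₁, gainTerm₁_eq, tsum_mul_left, Real.sqrt_mul (sq_nonneg _), Real.sqrt_sq (by positivity)]
  field_simp

theorem C₀_nonneg (S : SLData) (lam : ℕ → ℝ) (φ : ℕ → ℝ → ℝ) : 0 ≤ S.C₀ lam φ :=
  C₀_eq_sqrt_tsum S lam φ ▸ Real.sqrt_nonneg _

theorem C₁_nonneg (S : SLData) (lam : ℕ → ℝ) (φ : ℕ → ℝ → ℝ) : 0 ≤ S.C₁ lam φ :=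
  C₁_eq_sqrt_tsum S lam φ ▸ Real.sqrt_nonneg _

namespace IsEigensystem

variable {lam : ℕ → ℝ} {φ : ℕ → ℝ → ℝ}

theorem lam_mul_wInner_of_solvesBVP (hsys : S.IsEigensystem lam φ) (hv : S.SolvesBVP β₀ β₁ v)
    (n : ℕ) : lam n * S.wInner (φ n) v = S.trace₀ (φ n) * β₀ + S.trace₁ (φ n) * β₁ := by
  obtain ⟨hode, h0, h1⟩ := solvesBVP_iff.1 hv
  have h := hsys.wInner_A n hode.contDiffOn
  rw [wInner_comm, hode.wInner_A_left, zero_mul, h0, h1] at h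
  linarith

theorem hasSum_sq_of_solvesBVP (hsys : S.IsEigensystem lam φ) (h0 : ¬S.IsEigenvalue 0)
    (hv : S.SolvesBVP β₀ β₁ v) :
    HasSum (fun n => ((S.trace₀ (φ n) * β₀ + S.trace₁ (φ n) * β₁) / lam n) ^ 2)
      (S.norm v ^ 2) := by
  refine (hsys.hasSum_wInner_sq h0 (memL2_of_continuousOn hv.1.continuousOn)).congr_fun fun n => ?_
  have hlam : lam n ≠ 0 := fun h => h0 ((hsys.isEigenvalue_iff 0).2 ⟨n, h⟩)
  rw [← hsys.lam_mul_wInner_of_solvesBVP hv, mul_div_cancel_left₀ _ hlam]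

theorem hasSum_trace₀_sq_of_solvesBVP (hsys : S.IsEigensystem lam φ) (h0 : ¬S.IsEigenvalue 0)
    (hβ : β ≠ 0) (hv : S.SolvesBVP β 0 v) :
    HasSum (fun n => (S.trace₀ (φ n) / lam n) ^ 2) ((1 / β * S.norm v) ^ 2) := by
  rw [mul_pow]
  refine ((hsys.hasSum_sq_of_solvesBVP h0 hv).mul_left ((1 / β) ^ 2)).congr_fun fun n => ?_
  rw [mul_zero, add_zero, ← mul_pow]
  field_simp

theorem hasSum_trace₁_sq_of_solvesBVP (hsys : S.IsEigensystem lam φ) (h0 : ¬S.IsEigenvalue 0)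
    (hβ : β ≠ 0) (hv : S.SolvesBVP 0 β v) :
    HasSum (fun n => (S.trace₁ (φ n) / lam n) ^ 2) ((1 / β * S.norm v) ^ 2) := by
  rw [mul_pow]
  refine ((hsys.hasSum_sq_of_solvesBVP h0 hv).mul_left ((1 / β) ^ 2)).congr_fun fun n => ?_
  rw [mul_zero, zero_add, ← mul_pow]
  field_simp

theorem C₀_eq (hsys : S.IsEigensystem lam φ) (h0 : ¬S.IsEigenvalue 0) (hβ : 0 < β)
    (hv : S.SolvesBVP β 0 v) : S.C₀ lam φ = 1 / β * S.norm v := by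
  rw [C₀_eq_sqrt_tsum, (hsys.hasSum_trace₀_sq_of_solvesBVP h0 hβ.ne' hv).tsum_eq,
    Real.sqrt_sq (mul_nonneg (one_div_pos.2 hβ).le (norm_nonneg v))]

theorem C₁_eq (hsys : S.IsEigensystem lam φ) (h0 : ¬S.IsEigenvalue 0) (hβ : 0 < β)
    (hv : S.SolvesBVP 0 β v) : S.C₁ lam φ = 1 / β * S.norm v := by
  rw [C₁_eq_sqrt_tsum, (hsys.hasSum_trace₁_sq_of_solvesBVP h0 hβ.ne' hv).tsum_eq,
    Real.sqrt_sq (mul_nonneg (one_div_pos.2 hβ).le (norm_nonneg v))]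

theorem hasSum_trace₀_sq (hsys : S.IsEigensystem lam φ) (h0 : ¬S.IsEigenvalue 0) :
    HasSum (fun n => (S.trace₀ (φ n) / lam n) ^ 2) (S.C₀ lam φ ^ 2) := by
  obtain ⟨v, hv, -⟩ := exists_isUniqueBVPSolution h0 1 0
  rw [hsys.C₀_eq h0 one_pos hv]
  exact hsys.hasSum_trace₀_sq_of_solvesBVP h0 one_ne_zero hv

theorem hasSum_trace₁_sq (hsys : S.IsEigensystem lam φ) (h0 : ¬S.IsEigenvalue 0) :
    HasSum (fun n => (S.trace₁ (φ n) / lam n) ^ 2) (S.C₁ lam φ ^ 2) := by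
  obtain ⟨v, hv, -⟩ := exists_isUniqueBVPSolution h0 0 1
  rw [hsys.C₁_eq h0 one_pos hv]
  exact hsys.hasSum_trace₁_sq_of_solvesBVP h0 one_ne_zero hv

theorem summable_gainTerm₀ (hsys : S.IsEigensystem lam φ) (h0 : ¬S.IsEigenvalue 0) :
    Summable (S.gainTerm₀ lam φ) := by
  rw [gainTerm₀_eq]
  exact (hsys.hasSum_trace₀_sq h0).summable.mul_left _

theorem summable_gainTerm₁ (hsys : S.IsEigensystem lam φ) (h0 : ¬S.IsEigenvalue 0) :
    Summable (S.gainTerm₁ lam φ) := by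
  rw [gainTerm₁_eq]
  exact (hsys.hasSum_trace₁_sq h0).summable.mul_left _

end IsEigensystem

end SLData

/-! ### Time sequences and bounded inputs -/

namespace IsTimeSequence

variable {τ : ℕ → ℝ}

theorem nonneg (hτ : IsTimeSequence τ) (i : ℕ) : 0 ≤ τ i :=
  hτ.zero ▸ hτ.strictMono.monotone (Nat.zero_le i)

theorem exists_mem_Ico (hτ : IsTimeSequence τ) {t : ℝ} (ht : 0 ≤ t) :
    ∃ i, t ∈ Ico (τ i) (τ (i + 1)) := by
  have hunion := iUnion_Ico_map_succ_eq_Ici (f := τ)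
    (fun i => hτ.strictMono.monotone bot_le) (not_bddAbove_of_tendsto_atTop hτ.tendsto)
  have hmem : t ∈ ⋃ i, Ico (τ i) (τ (Order.succ i)) := by
    rw [hunion, Nat.bot_eq_zero, hτ.zero]
    exact ht
  exact mem_iUnion.1 hmem

theorem regularTimes_eq_iUnion (hτ : IsTimeSequence τ) :
    regularTimes τ = ⋃ i, Ioo (τ i) (τ (i + 1)) := by
  ext t
  refine ⟨fun ht => ?_, fun ht => ?_⟩
  · obtain ⟨i, hi⟩ := hτ.exists_mem_Ico ht.1
    exact mem_iUnion.2 ⟨i, hi.1.lt_of_ne fun h => ht.2 ⟨i, h⟩, hi.2⟩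
  · obtain ⟨i, hi⟩ := mem_iUnion.1 ht
    refine ⟨(hτ.nonneg i).trans hi.1.le, ?_⟩
    rintro ⟨k, rfl⟩
    have hik := hτ.strictMono.lt_iff_lt.1 hi.1
    have hki := hτ.strictMono.lt_iff_lt.1 hi.2
    omega

theorem Ioo_subset_regularTimes (hτ : IsTimeSequence τ) (i : ℕ) :
    Ioo (τ i) (τ (i + 1)) ⊆ regularTimes τ :=
  hτ.regularTimes_eq_iUnion ▸ subset_iUnion (fun i => Ioo (τ i) (τ (i + 1))) i

theorem isOpen_regularTimes (hτ : IsTimeSequence τ) : IsOpen (regularTimes τ) :=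
  hτ.regularTimes_eq_iUnion ▸ isOpen_iUnion fun _ => isOpen_Ioo

theorem pos_of_mem_regularTimes (hτ : IsTimeSequence τ) {t : ℝ} (ht : t ∈ regularTimes τ) :
    0 < t :=
  lt_of_le_of_ne ht.1 fun h => ht.2 ⟨0, hτ.zero.trans h⟩

theorem bddAbove_image_Ioo (hτ : IsTimeSequence τ) {F : ℝ → ℝ}
    (hF : ∀ i, BddAbove (F '' Ioo (τ i) (τ (i + 1)))) (t : ℝ) : BddAbove (F '' Ioo 0 t) := by
  obtain ⟨N, hN⟩ := (hτ.tendsto.eventually_ge_atTop t).exists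
  have hcover : Ioo 0 t ⊆ ⋃ i ∈ Finset.range N, Ico (τ i) (τ (i + 1)) := by
    intro s hs
    obtain ⟨i, hi⟩ := hτ.exists_mem_Ico hs.1.le
    have hiN : i < N := hτ.strictMono.lt_iff_lt.1 (hi.1.trans_lt (hs.2.trans_le hN))
    exact mem_biUnion (Finset.mem_range.2 hiN) hi
  refine BddAbove.mono (image_mono hcover) ?_
  rw [image_iUnion₂]
  refine (Finset.range N).finite_toSet.bddAbove_biUnion.2 fun i _ => ?_
  rw [← Ioo_insert_left (hτ.strictMono i.lt_succ_self), image_insert_eq]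
  exact (hF i).insert _

end IsTimeSequence

theorem IsGBWith.bddAbove_image_abs {τ : ℕ → ℝ} {d : ℝ → ℝ} (hd : IsGBWith τ d)
    (hτ : IsTimeSequence τ) (t : ℝ) : BddAbove ((fun s => |d s|) '' Ioo 0 t) := by
  refine hτ.bddAbove_image_Ioo (fun i => ?_) t
  obtain ⟨M, hM⟩ := hd.2.2.2 i
  obtain ⟨m, hm⟩ := nonempty_Ioo.2 (hτ.strictMono i.lt_succ_self)
  have hdiff : ∀ x ∈ Ioo (τ i) (τ (i + 1)), DifferentiableAt ℝ d x := fun x hx =>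
    (hd.2.1.differentiableOn two_ne_zero).differentiableAt
      (hτ.isOpen_regularTimes.mem_nhds (hτ.Ioo_subset_regularTimes i hx))
  refine ⟨|d m| + M * (τ (i + 1) - τ i), forall_mem_image.2 fun s hs => ?_⟩
  have hsm : |s - m| ≤ τ (i + 1) - τ i :=
    abs_le.2 ⟨by linarith [hs.1, hm.2], by linarith [hs.2, hm.1]⟩
  calc |d s| ≤ |d m| + |d s - d m| := by simpa using abs_add_le (d m) (d s - d m)
    _ ≤ |d m| + M * |s - m| := by
        gcongr
        exact (convex_Ioo _ _).norm_image_sub_le_of_norm_deriv_le hdiff hM hm hs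
    _ ≤ |d m| + M * (τ (i + 1) - τ i) := by
        gcongr
        exact (abs_nonneg _).trans (hM m hm)

theorem SLData.IsGDWith.bddAbove_image_norm {S : SLData} {τ : ℕ → ℝ} {f : ℝ → ℝ → ℝ}
    (hf : S.IsGDWith τ f) (hτ : IsTimeSequence τ) (t : ℝ) :
    BddAbove ((fun s => S.norm (f s)) '' Ioo 0 t) := by
  refine hτ.bddAbove_image_Ioo (fun i => ?_) t
  obtain ⟨f₁, f₂, a, b, c, -, -, -, -, -, hprofile, ⟨M, hM⟩, -⟩ := hf i
  refine ⟨√(2 * M), forall_mem_image.2 fun s hs => Real.sqrt_le_sqrt ?_⟩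
  obtain ⟨⟨hf₁, -⟩, ⟨-, hf₂⟩, hsum⟩ := hprofile s hs
  have hfs : ContinuousOn (f s) (Icc 0 1) := (hf₁.add hf₂.continuousOn).congr hsum
  calc ∫ x in (0 : ℝ)..1, S.r x * f s x ^ 2
      ≤ ∫ x in (0 : ℝ)..1, 2 * (S.r x * (f₁ s x ^ 2 + f₂ s x ^ 2 + S.A (f₂ s) x ^ 2)) := by
        refine intervalIntegral.integral_mono_on zero_le_one
          ((S.r_continuousOn.mul (hfs.pow 2)).intervalIntegrable_of_Icc zero_le_one)
          ((continuousOn_const.mul (S.r_continuousOn.mul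
            (((hf₁.pow 2).add (hf₂.continuousOn.pow 2)).add
              ((continuousOn_A hf₂).pow 2)))).intervalIntegrable_of_Icc zero_le_one)
          fun x hx => ?_
        have hr := (S.r_pos x hx).le
        rw [hsum x hx]
        nlinarith [mul_nonneg hr (sq_nonneg (f₁ s x - f₂ s x)),
          mul_nonneg hr (sq_nonneg (S.A (f₂ s) x))]
    _ = 2 * ∫ x in (0 : ℝ)..1, S.r x * (f₁ s x ^ 2 + f₂ s x ^ 2 + S.A (f₂ s) x ^ 2) :=
        intervalIntegral.integral_const_mul _ _
    _ ≤ 2 * M := by gcongr; exact hM s hs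

/-! ### Modal equations -/

theorem hasDerivAt_integral_of_continuousOn {F F' : ℝ → ℝ → ℝ} {U : Set ℝ} {a b t : ℝ}
    (hab : a ≤ b) (hU : IsOpen U) (ht : t ∈ U) (hF : ∀ s ∈ U, ContinuousOn (F s) (Icc a b))
    (hF' : ContinuousOn (Function.uncurry F') (U ×ˢ Icc a b))
    (hderiv : ∀ s ∈ U, ∀ x ∈ Icc a b, HasDerivAt (fun s => F s x) (F' s x) s) :
    HasDerivAt (fun s => ∫ x in a..b, F s x) (∫ x in a..b, F' t x) t := by
  obtain ⟨ε, hε, hball⟩ := Metric.nhds_basis_closedBall.mem_iff.1 (hU.mem_nhds ht)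
  obtain ⟨M, hM⟩ := ((isCompact_closedBall t ε).prod isCompact_Icc).exists_bound_of_continuousOn
    (hF'.mono (prod_mono_left hball))
  have hI : uIoc a b ⊆ Icc a b := uIoc_of_le hab ▸ Ioc_subset_Icc_self
  have hF't : ContinuousOn (F' t) (Icc a b) :=
    hF'.uncurry_left t ht
  refine (intervalIntegral.hasDerivAt_integral_of_dominated_loc_of_deriv_le (μ := volume)
    (F' := F') (bound := fun _ => M) (Metric.closedBall_mem_nhds t hε) ?_
    ((hF t ht).intervalIntegrable_of_Icc hab)
    ((hF't.mono hI).aestronglyMeasurable measurableSet_uIoc)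
    (.of_forall fun x hx s hs => hM (s, x) ⟨hs, hI hx⟩) intervalIntegrable_const
    (.of_forall fun x hx s hs => hderiv s (hball hs) x (hI hx))).2
  filter_upwards [hU.mem_nhds ht] with s hs
  exact ((hF s hs).mono hI).aestronglyMeasurable measurableSet_uIoc

theorem hasDerivWithinAt_fst {F : ℝ × ℝ → ℝ} {F' : ℝ × ℝ →L[ℝ] ℝ} {s t : Set ℝ} {z : ℝ × ℝ}
    (hF : HasFDerivWithinAt F F' (s ×ˢ t) z) (hz : z.2 ∈ t) :
    HasDerivWithinAt (fun x => F (x, z.2)) (F' (1, 0)) s z.1 :=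
  have hline := (hasDerivWithinAt_id z.1 s).prodMk (hasDerivWithinAt_const z.1 s z.2)
  hF.comp_hasDerivWithinAt z.1 hline fun _ hx => mk_mem_prod hx hz

theorem hasDerivWithinAt_snd {F : ℝ × ℝ → ℝ} {F' : ℝ × ℝ →L[ℝ] ℝ} {s t : Set ℝ} {z : ℝ × ℝ}
    (hF : HasFDerivWithinAt F F' (s ×ˢ t) z) (hz : z.1 ∈ s) :
    HasDerivWithinAt (fun y => F (z.1, y)) (F' (0, 1)) t z.2 :=
  have hline := (hasDerivWithinAt_const z.2 t z.1).prodMk (hasDerivWithinAt_id z.2 t)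
  hF.comp_hasDerivWithinAt z.2 hline fun _ hy => mk_mem_prod hz hy

/-- The partial derivative `∂ₜ u` of a function of time and space, the counterpart of `dx`. -/
noncomputable def dt (u : ℝ → ℝ → ℝ) (t x : ℝ) : ℝ := deriv (fun s => u s x) t

theorem ae_mem_regularTimes (τ : ℕ → ℝ) (t : ℝ) :
    ∀ᵐ s ∂volume.restrict (Ioo 0 t), s ∈ regularTimes τ := by
  filter_upwards [ae_restrict_mem measurableSet_Ioo,
    ae_restrict_of_ae ((countable_range τ).ae_notMem volume)] with s hs hsτ
  exact ⟨hs.1.le, hsτ⟩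

theorem IsTimeSequence.aestronglyMeasurable_of_continuousOn {τ : ℕ → ℝ} (hτ : IsTimeSequence τ)
    {F : ℝ → ℝ} (hF : ContinuousOn F (regularTimes τ)) (t : ℝ) :
    AEStronglyMeasurable F (volume.restrict (Ioo 0 t)) := by
  have hsubset : Ioo 0 t ≤ᵐ[volume] regularTimes τ :=
    (ae_restrict_iff' measurableSet_Ioo).1 (ae_mem_regularTimes τ t)
  exact (hF.aestronglyMeasurable hτ.isOpen_regularTimes.measurableSet).mono_measure
    (Measure.restrict_mono_ae hsubset)

theorem intervalIntegrable_of_abs_le {F G : ℝ → ℝ} {t : ℝ} (ht : 0 ≤ t)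
    (hmeas : AEStronglyMeasurable F (volume.restrict (Ioo 0 t)))
    (hG : IntervalIntegrable G volume 0 t) (hF : ∀ᵐ s ∂volume.restrict (Ioo 0 t), |F s| ≤ G s) :
    IntervalIntegrable F volume 0 t := by
  rw [intervalIntegrable_iff_integrableOn_Ioo_of_le ht] at hG ⊢
  exact hG.mono' hmeas hF

namespace SLData

variable {S : SLData} {g h : ℝ → ℝ}

theorem MemL2.sub (hg : S.MemL2 g) (hh : S.MemL2 h) : S.MemL2 (g - h) :=
  ⟨hg.1.sub hh.1, integrable_unitInterval_iff.1
    (integrable_weightedMeasure_iff.1 (hg.memLp.sub hh.memLp).integrable_sq)⟩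

theorem toL2_sub (hg : S.MemL2 g) (hh : S.MemL2 h) : toL2 (hg.sub hh) = toL2 hg - toL2 hh :=
  MemLp.toLp_sub hg.memLp hh.memLp

theorem abs_wInner_le (hg : S.MemL2 g) (hh : S.MemL2 h) :
    |S.wInner g h| ≤ S.norm g * S.norm h := by
  rw [← inner_toL2 hg hh, ← norm_toL2 hg, ← norm_toL2 hh]
  exact abs_real_inner_le_norm _ _

theorem MemL2.congr_Ioo (hg : S.MemL2 g) (hgh : EqOn g h (Ioo 0 1)) : S.MemL2 h := by
  refine ⟨hg.1.congr ?_, hg.2.congr_uIoo fun x hx => ?_⟩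
  · rw [← restrict_Ioo_eq_restrict_Ioc]
    exact ae_restrict_of_forall_mem measurableSet_Ioo hgh
  · rw [uIoo_of_le zero_le_one] at hx
    simp only [hgh hx]

theorem wInner_congr_Ioo (φ : ℝ → ℝ) (hgh : EqOn g h (Ioo 0 1)) :
    S.wInner φ g = S.wInner φ h :=
  intervalIntegral.integral_congr_Ioo_of_le zero_le_one fun x hx => by simp only [hgh hx]

namespace IsSolutionWith

variable {τ : ℕ → ℝ} {f : ℝ → ℝ → ℝ} {u₀ d₀ d₁ : ℝ → ℝ} {u : ℝ → ℝ → ℝ}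

theorem continuousOn_wInner (hu : S.IsSolutionWith τ u₀ f d₀ d₁ u) {φ : ℝ → ℝ}
    (hφ : S.MemL2 φ) : ContinuousOn (fun s => S.wInner φ (u s)) (Ici 0) := by
  intro t ht
  have hbound : Tendsto (fun s => S.norm φ * S.norm (u s - u t)) (𝓝[Ici 0] t) (𝓝 0) := by
    have h := (hu.continuous_L2 t ht).const_mul (S.norm φ)
    rwa [mul_zero] at h
  refine tendsto_iff_dist_tendsto_zero.2
    (squeeze_zero' (.of_forall fun _ => dist_nonneg) ?_ hbound)
  filter_upwards [self_mem_nhdsWithin] with s hs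
  have hst := (hu.memL2 s hs).sub (hu.memL2 t ht)
  calc dist (S.wInner φ (u s)) (S.wInner φ (u t)) = |S.wInner φ (u s - u t)| := by
        rw [Real.dist_eq, ← inner_toL2 hφ (hu.memL2 s hs), ← inner_toL2 hφ (hu.memL2 t ht),
          ← inner_sub_right, ← toL2_sub, inner_toL2]
    _ ≤ S.norm φ * S.norm (u s - u t) := abs_wInner_le hφ hst

theorem hasFDerivWithinAt_uncurry (hu : S.IsSolutionWith τ u₀ f d₀ d₁ u) {z : ℝ × ℝ}
    (hz : z ∈ regularTimes τ ×ˢ Icc (0 : ℝ) 1) :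
    HasFDerivWithinAt (Function.uncurry u)
      (fderivWithin ℝ (Function.uncurry u) (regularTimes τ ×ˢ Icc (0 : ℝ) 1) z)
      (regularTimes τ ×ˢ Icc (0 : ℝ) 1) z :=
  (hu.contDiffOn.differentiableOn one_ne_zero z hz).hasFDerivWithinAt

theorem continuousOn_fderivWithin_uncurry (hu : S.IsSolutionWith τ u₀ f d₀ d₁ u)
    (hτ : IsTimeSequence τ) :
    ContinuousOn (fderivWithin ℝ (Function.uncurry u) (regularTimes τ ×ˢ Icc (0 : ℝ) 1))
      (regularTimes τ ×ˢ Icc (0 : ℝ) 1) :=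
  hu.contDiffOn.continuousOn_fderivWithin
    (hτ.isOpen_regularTimes.uniqueDiffOn.prod (uniqueDiffOn_Icc zero_lt_one)) le_rfl

theorem hasDerivAt_fderivWithin (hu : S.IsSolutionWith τ u₀ f d₀ d₁ u) (hτ : IsTimeSequence τ)
    {z : ℝ × ℝ} (hz : z ∈ regularTimes τ ×ˢ Icc (0 : ℝ) 1) :
    HasDerivAt (fun s => u s z.2)
      (fderivWithin ℝ (Function.uncurry u) (regularTimes τ ×ˢ Icc (0 : ℝ) 1) z (1, 0)) z.1 :=
  (hasDerivWithinAt_fst (hu.hasFDerivWithinAt_uncurry hz) hz.2).hasDerivAt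
    (hτ.isOpen_regularTimes.mem_nhds hz.1)

theorem hasDerivAt_dt (hu : S.IsSolutionWith τ u₀ f d₀ d₁ u) (hτ : IsTimeSequence τ) {t x : ℝ}
    (ht : t ∈ regularTimes τ) (hx : x ∈ Icc (0 : ℝ) 1) :
    HasDerivAt (fun s => u s x) (dt u t x) t :=
  (hu.hasDerivAt_fderivWithin hτ ⟨ht, hx⟩ : HasDerivAt _ _ (t, x).1).differentiableAt.hasDerivAt

theorem continuousOn_dt (hu : S.IsSolutionWith τ u₀ f d₀ d₁ u) (hτ : IsTimeSequence τ) :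
    ContinuousOn (Function.uncurry (dt u)) (regularTimes τ ×ˢ Icc (0 : ℝ) 1) :=
  ((hu.continuousOn_fderivWithin_uncurry hτ).clm_apply continuousOn_const).congr fun _ hz =>
    (hu.hasDerivAt_fderivWithin hτ hz).deriv

theorem continuousOn_dx (hu : S.IsSolutionWith τ u₀ f d₀ d₁ u) (hτ : IsTimeSequence τ) {x : ℝ}
    (hx : x ∈ Icc (0 : ℝ) 1) : ContinuousOn (fun t => dx (u t) x) (regularTimes τ) := by
  have hline : ContinuousOn (fun t : ℝ => (t, x)) (regularTimes τ) := by fun_prop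
  have hderiv := (hu.continuousOn_fderivWithin_uncurry hτ).comp hline fun t ht => ⟨ht, hx⟩
  refine (hderiv.clm_apply (continuousOn_const (c := ((0 : ℝ), (1 : ℝ))))).congr fun t ht => ?_
  exact (hasDerivWithinAt_snd (hu.hasFDerivWithinAt_uncurry (z := (t, x)) ⟨ht, hx⟩)
    ht).derivWithin (uniqueDiffOn_Icc zero_lt_one x hx)

theorem continuousOn_apply (hu : S.IsSolutionWith τ u₀ f d₀ d₁ u) {x : ℝ}
    (hx : x ∈ Icc (0 : ℝ) 1) : ContinuousOn (fun t => u t x) (regularTimes τ) :=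
  hu.contDiffOn.continuousOn.uncurry_right x hx

theorem continuousOn_d₀ (hu : S.IsSolutionWith τ u₀ f d₀ d₁ u) (hτ : IsTimeSequence τ) :
    ContinuousOn d₀ (regularTimes τ) := by
  have h0 : (0 : ℝ) ∈ Icc (0 : ℝ) 1 := left_mem_Icc.2 zero_le_one
  exact ((continuousOn_const.mul (hu.continuousOn_apply h0)).add
    (continuousOn_const.mul (hu.continuousOn_dx hτ h0))).congr fun t ht =>
      (hu.boundary0 t ht).symm

theorem continuousOn_d₁ (hu : S.IsSolutionWith τ u₀ f d₀ d₁ u) (hτ : IsTimeSequence τ) :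
    ContinuousOn d₁ (regularTimes τ) := by
  have h1 : (1 : ℝ) ∈ Icc (0 : ℝ) 1 := right_mem_Icc.2 zero_le_one
  exact ((continuousOn_const.mul (hu.continuousOn_apply h1)).add
    (continuousOn_const.mul (hu.continuousOn_dx hτ h1))).congr fun t ht =>
      (hu.boundary1 t ht).symm

theorem eqOn_dt_add_A (hu : S.IsSolutionWith τ u₀ f d₀ d₁ u) {t : ℝ} (ht : t ∈ regularTimes τ) :
    EqOn (fun x => dt u t x + S.A (u t) x) (f t) (Ioo 0 1) :=
  hu.pde t ht

theorem continuousOn_dt_left (hu : S.IsSolutionWith τ u₀ f d₀ d₁ u) (hτ : IsTimeSequence τ)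
    {t : ℝ} (ht : t ∈ regularTimes τ) : ContinuousOn (dt u t) (Icc 0 1) :=
  (hu.continuousOn_dt hτ).uncurry_left t ht

theorem memL2_input (hu : S.IsSolutionWith τ u₀ f d₀ d₁ u) (hτ : IsTimeSequence τ) {t : ℝ}
    (ht : t ∈ regularTimes τ) : S.MemL2 (f t) :=
  (memL2_of_continuousOn ((hu.continuousOn_dt_left hτ ht).add
    (continuousOn_A (hu.contDiffOn_profile t (hτ.pos_of_mem_regularTimes ht))))).congr_Ioo
      (hu.eqOn_dt_add_A ht)

theorem hasDerivAt_wInner (hu : S.IsSolutionWith τ u₀ f d₀ d₁ u) (hτ : IsTimeSequence τ)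
    {φ : ℝ → ℝ} (hφ : ContinuousOn φ (Icc 0 1)) {t : ℝ} (ht : t ∈ regularTimes τ) :
    HasDerivAt (fun s => S.wInner φ (u s)) (S.wInner φ (dt u t)) t := by
  have hrφ : ContinuousOn (fun x => S.r x * φ x) (Icc 0 1) := S.r_continuousOn.mul hφ
  refine hasDerivAt_integral_of_continuousOn zero_le_one hτ.isOpen_regularTimes ht
    (F' := fun s x => S.r x * φ x * dt u s x) (fun s hs => ?_) ?_ fun s hs x hx => ?_
  · exact hrφ.mul (hu.contDiffOn_profile s (hτ.pos_of_mem_regularTimes hs)).continuousOn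
  · exact (hrφ.comp continuousOn_snd fun _ hz => hz.2).mul (hu.continuousOn_dt hτ)
  · exact (hu.hasDerivAt_dt hτ hs hx).const_mul _

theorem wInner_dt (hu : S.IsSolutionWith τ u₀ f d₀ d₁ u) (hτ : IsTimeSequence τ)
    {lam : ℕ → ℝ} {φ : ℕ → ℝ → ℝ} (hsys : S.IsEigensystem lam φ) (n : ℕ) {t : ℝ}
    (ht : t ∈ regularTimes τ) :
    S.wInner (φ n) (dt u t) = -lam n * S.wInner (φ n) (u t) +
      (S.wInner (φ n) (f t) + S.trace₀ (φ n) * d₀ t + S.trace₁ (φ n) * d₁ t) := by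
  have hprofile := hu.contDiffOn_profile t (hτ.pos_of_mem_regularTimes ht)
  have hAmem : S.MemL2 (S.A (u t)) := memL2_of_continuousOn (continuousOn_A hprofile)
  have hf := hu.memL2_input hτ ht
  have hdt : EqOn (dt u t) (f t - S.A (u t)) (Ioo 0 1) := fun x hx =>
    eq_sub_of_add_eq (hu.pde t ht x hx)
  have hsub : S.wInner (φ n) (dt u t) = S.wInner (φ n) (f t) - S.wInner (φ n) (S.A (u t)) := by
    rw [wInner_congr_Ioo _ hdt, ← inner_toL2 (hsys.memL2 n) (hf.sub hAmem), toL2_sub hf hAmem,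
      inner_sub_right, inner_toL2, inner_toL2]
  rw [hsub, hsys.wInner_A n hprofile, hu.boundary0 t ht, hu.boundary1 t ht]
  ring

theorem aestronglyMeasurable_wInner_input (hu : S.IsSolutionWith τ u₀ f d₀ d₁ u)
    (hτ : IsTimeSequence τ) {lam : ℕ → ℝ} {φ : ℕ → ℝ → ℝ} (hsys : S.IsEigensystem lam φ)
    (n : ℕ) (t : ℝ) :
    AEStronglyMeasurable (fun s => S.wInner (φ n) (f s)) (volume.restrict (Ioo 0 t)) := by
  set c : ℝ → ℝ := fun s => S.wInner (φ n) (u s)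
  have hφ : ContinuousOn (φ n) (Icc 0 1) := (hsys.contDiffOn n).continuousOn
  have hc : AEStronglyMeasurable c (volume.restrict (Ioo 0 t)) :=
    ((hu.continuousOn_wInner (hsys.memL2 n)).mono
      (Ioo_subset_Icc_self.trans Icc_subset_Ici_self)).aestronglyMeasurable measurableSet_Ioo
  have hd₀ := hτ.aestronglyMeasurable_of_continuousOn (hu.continuousOn_d₀ hτ) t
  have hd₁ := hτ.aestronglyMeasurable_of_continuousOn (hu.continuousOn_d₁ hτ) t
  refine (((((aestronglyMeasurable_deriv c _).add (hc.const_mul (lam n))).sub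
    (hd₀.const_mul (S.trace₀ (φ n)))).sub (hd₁.const_mul (S.trace₁ (φ n))))).congr ?_
  filter_upwards [ae_mem_regularTimes τ t] with s hs
  have hderiv : deriv c s = _ :=
    (hu.hasDerivAt_wInner hτ hφ hs).deriv.trans (hu.wInner_dt hτ hsys n hs)
  simp only [Pi.add_apply, Pi.sub_apply, hderiv, c]
  ring

theorem wInner_initial (hu : S.IsSolutionWith τ u₀ f d₀ d₁ u) (φ : ℝ → ℝ) :
    S.wInner φ (u 0) = S.wInner φ u₀ :=
  wInner_congr_Ioo φ fun x hx => hu.initial x (Ioo_subset_Icc_self hx)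

theorem memL2_initial (hu : S.IsSolutionWith τ u₀ f d₀ d₁ u) : S.MemL2 u₀ :=
  (hu.memL2 0 le_rfl).congr_Ioo fun x hx => hu.initial x (Ioo_subset_Icc_self hx)

end IsSolutionWith

end SLData

/-! ### Exponentially weighted estimates -/

theorem hasDerivAt_exp_neg_mul_sub (a t s : ℝ) :
    HasDerivAt (fun s => Real.exp (-a * (t - s))) (Real.exp (-a * (t - s)) * a) s := by
  have hlin : HasDerivAt (fun s => -a * (t - s)) a s := by
    simpa using ((hasDerivAt_id s).const_sub t).const_mul (-a)
  exact hlin.exp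

theorem eq_exp_mul_add_integral {c g : ℝ → ℝ} {μ t : ℝ} {Z : Set ℝ} (ht : 0 ≤ t)
    (hZ : Z.Countable) (hc : ContinuousOn c (Icc 0 t))
    (hderiv : ∀ s ∈ Ioo 0 t \ Z, HasDerivAt c (-μ * c s + g s) s)
    (hg : IntervalIntegrable g volume 0 t) :
    c t = Real.exp (-μ * t) * c 0 + ∫ s in (0 : ℝ)..t, Real.exp (-μ * (t - s)) * g s := by
  have hprod (s : ℝ) (hs : s ∈ Ioo 0 t \ Z) :
      HasDerivAt (fun s => Real.exp (-μ * (t - s)) * c s) (Real.exp (-μ * (t - s)) * g s) s := by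
    refine ((hasDerivAt_exp_neg_mul_sub μ t s).fun_mul (hderiv s hs)).congr_deriv ?_
    ring
  have hftc := integral_eq_of_hasDerivAt_off_countable_of_le
    (fun s => Real.exp (-μ * (t - s)) * c s) (fun s => Real.exp (-μ * (t - s)) * g s) ht hZ
    ((by fun_prop : Continuous fun s => Real.exp (-μ * (t - s))).continuousOn.mul hc) hprod
    (hg.continuousOn_mul (by fun_prop))
  simp only [sub_self, mul_zero, Real.exp_zero, one_mul, sub_zero] at hftc
  linarith

theorem integral_exp_neg_mul_sub_le {a t : ℝ} (ha : 0 < a) :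
    ∫ s in (0 : ℝ)..t, Real.exp (-a * (t - s)) ≤ 1 / a := by
  have hexp (s : ℝ) : HasDerivAt (fun s => Real.exp (-a * (t - s)) / a)
      (Real.exp (-a * (t - s))) s := by
    simpa only [mul_div_cancel_right₀ _ ha.ne'] using
      (hasDerivAt_exp_neg_mul_sub a t s).div_const a
  rw [intervalIntegral.integral_eq_sub_of_hasDerivAt (fun s _ => hexp s)
    (Continuous.intervalIntegrable (by fun_prop) _ _), sub_self, mul_zero, Real.exp_zero]
  exact sub_le_self _ (by positivity)

theorem norm_integral_le_of_norm_le_exp {E : Type*} [NormedAddCommGroup E] [NormedSpace ℝ E]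
    {Y : ℝ → E} {a σ t D : ℝ} (hσ : σ < a) (ht : 0 ≤ t) (hD : 0 ≤ D)
    (hY : ∀ᵐ s ∂volume.restrict (Ioo 0 t),
      ‖Y s‖ ≤ Real.exp (-a * (t - s)) * (D * Real.exp (σ * (t - s)))) :
    ‖∫ s in (0 : ℝ)..t, Y s‖ ≤ D / (a - σ) := by
  have hmul (s : ℝ) : Real.exp (-a * (t - s)) * (D * Real.exp (σ * (t - s))) =
      D * Real.exp (-(a - σ) * (t - s)) := by
    rw [mul_left_comm, ← Real.exp_add]
    ring_nf
  simp only [hmul, restrict_Ioo_eq_restrict_Ioc] at hY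
  calc ‖∫ s in (0 : ℝ)..t, Y s‖ ≤ ∫ s in (0 : ℝ)..t, D * Real.exp (-(a - σ) * (t - s)) := by
        exact intervalIntegral.norm_integral_le_of_norm_le ht
          ((ae_restrict_iff' measurableSet_Ioc).1 hY)
          (Continuous.intervalIntegrable (by fun_prop) _ _)
    _ ≤ D * (1 / (a - σ)) := by
        rw [intervalIntegral.integral_const_mul]
        exact mul_le_mul_of_nonneg_left (integral_exp_neg_mul_sub_le (sub_pos.2 hσ)) hD
    _ = D / (a - σ) := mul_one_div _ _

section EuclideanSpace

variable {ι : Type*} [Fintype ι]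

theorem euclideanSpace_norm_le_of_forall_abs_le {x y : EuclideanSpace ℝ ι}
    (h : ∀ i, |x i| ≤ |y i|) : ‖x‖ ≤ ‖y‖ := by
  simp only [EuclideanSpace.norm_eq, Real.norm_eq_abs]
  exact Real.sqrt_le_sqrt (Finset.sum_le_sum fun i _ => pow_le_pow_left₀ (abs_nonneg _) (h i) 2)

theorem norm_toLp_exp_mul_le {ν : ι → ℝ} {m t : ℝ} (hν : ∀ i, m ≤ ν i) (ht : 0 ≤ t)
    (x : EuclideanSpace ℝ ι) :
    ‖WithLp.toLp 2 fun i => Real.exp (-ν i * t) * x i‖ ≤ Real.exp (-m * t) * ‖x‖ := by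
  rw [← abs_of_pos (Real.exp_pos (-m * t)), ← Real.norm_eq_abs, ← norm_smul]
  refine euclideanSpace_norm_le_of_forall_abs_le fun i => ?_
  simp only [PiLp.smul_apply, smul_eq_mul, abs_mul, Real.abs_exp]
  gcongr
  exact hν i

theorem norm_toLp_integral_exp_mul_le {ν : ι → ℝ} {m σ t F : ℝ} (hν : ∀ i, m ≤ ν i)
    (hσ : σ < m) (ht : 0 ≤ t) (hF : 0 ≤ F) {y : ι → ℝ → ℝ}
    (hy : ∀ i, IntervalIntegrable (y i) volume 0 t)
    (hyF : ∀ᵐ s ∂volume.restrict (Ioo 0 t),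
      ‖WithLp.toLp 2 fun i => y i s‖ ≤ F * Real.exp (σ * (t - s))) :
    ‖WithLp.toLp 2 fun i => ∫ s in (0 : ℝ)..t, Real.exp (-ν i * (t - s)) * y i s‖ ≤
      F / (m - σ) := by
  let Y (s : ℝ) : EuclideanSpace ℝ ι := WithLp.toLp 2 fun i => Real.exp (-ν i * (t - s)) * y i s
  have hY (i : ι) : Integrable (fun s => Y s i) (volume.restrict (Ioc 0 t)) :=
    ((hy i).continuousOn_mul (by fun_prop)).1
  have heval : (WithLp.toLp 2 fun i => ∫ s in (0 : ℝ)..t, Real.exp (-ν i * (t - s)) * y i s) =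
      ∫ s in (0 : ℝ)..t, Y s := by
    simp only [intervalIntegral.integral_of_le ht]
    ext i
    exact (eval_integral_piLp hY i).symm
  rw [heval]
  refine norm_integral_le_of_norm_le_exp hσ ht hF ?_
  filter_upwards [hyF, ae_restrict_mem measurableSet_Ioo] with s hys hs
  exact (norm_toLp_exp_mul_le hν (sub_pos.2 hs.2).le (WithLp.toLp 2 fun i => y i s)).trans
    (mul_le_mul_of_nonneg_left hys (Real.exp_pos _).le)

theorem norm_toLp_mul_integral_exp_le {ν β : ι → ℝ} {m σ t D : ℝ} (hν : ∀ i, m ≤ ν i)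
    (hσ0 : 0 ≤ σ) (hσ : σ < m) (ht : 0 ≤ t) (hD : 0 ≤ D) {d : ℝ → ℝ}
    (hd : ∀ s ∈ Ioo 0 t, |d s| ≤ D * Real.exp (σ * (t - s))) :
    ‖WithLp.toLp 2 fun i => β i * ∫ s in (0 : ℝ)..t, Real.exp (-ν i * (t - s)) * d s‖ ≤
      m / (m - σ) * D * ‖WithLp.toLp 2 fun i => β i / ν i‖ := by
  have hm : 0 < m := hσ0.trans_lt hσ
  have hK : 0 ≤ m / (m - σ) * D := mul_nonneg (div_nonneg hm.le (sub_pos.2 hσ).le) hD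
  have hgain (i : ι) : D / (ν i - σ) ≤ m / (m - σ) * D / ν i := by
    have hmσ : 0 < m - σ := sub_pos.2 hσ
    have hνσ : 0 < ν i - σ := hmσ.trans_le (sub_le_sub_right (hν i) σ)
    rw [div_mul_eq_mul_div, div_div, div_le_div_iff₀ hνσ (mul_pos hmσ (hm.trans_le (hν i)))]
    nlinarith [mul_nonneg (mul_nonneg hD hσ0) (sub_nonneg.2 (hν i))]
  have hcoeff (i : ι) : |∫ s in (0 : ℝ)..t, Real.exp (-ν i * (t - s)) * d s| ≤ D / (ν i - σ) := by
    rw [← Real.norm_eq_abs]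
    refine norm_integral_le_of_norm_le_exp (hσ.trans_le (hν i)) ht hD
      (ae_restrict_of_forall_mem measurableSet_Ioo fun s hs => ?_)
    rw [Real.norm_eq_abs, abs_mul, Real.abs_exp]
    exact mul_le_mul_of_nonneg_left (hd s hs) (Real.exp_pos _).le
  rw [← abs_of_nonneg hK, ← Real.norm_eq_abs, ← norm_smul]
  refine euclideanSpace_norm_le_of_forall_abs_le fun i => ?_
  rw [PiLp.smul_apply, smul_eq_mul, abs_mul, abs_mul, abs_of_nonneg hK, abs_div,
    abs_of_pos (hm.trans_le (hν i)), mul_div_left_comm]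
  exact mul_le_mul_of_nonneg_left ((hcoeff i).trans (hgain i)) (abs_nonneg _)

end EuclideanSpace

theorem norm_toLp_le_of_hasSum_sq {ι : Type*} {a : ι → ℝ} {C : ℝ}
    (ha : HasSum (fun i => a i ^ 2) (C ^ 2)) (hC : 0 ≤ C) (s : Finset ι) :
    ‖WithLp.toLp 2 fun i : s => a i‖ ≤ C := by
  rw [EuclideanSpace.norm_eq]
  refine Real.sqrt_le_iff.2 ⟨hC, ?_⟩
  simp only [Real.norm_eq_abs, sq_abs]
  rw [Finset.sum_coe_sort s fun i => a i ^ 2]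
  exact sum_le_hasSum s (fun i _ => sq_nonneg (a i)) ha

theorem le_of_hasSum_sq_of_forall_norm_toLp_le {ι : Type*} {a : ι → ℝ} {B C : ℝ}
    (ha : HasSum (fun i => a i ^ 2) (C ^ 2))
    (hB : ∀ s : Finset ι, ‖WithLp.toLp 2 fun i : s => a i‖ ≤ B) : C ≤ B := by
  have hB0 : 0 ≤ B := (norm_nonneg _).trans (hB ∅)
  refine le_of_sq_le_sq (hasSum_le_of_sum_le ha fun s => ?_) hB0
  have h := pow_le_pow_left₀ (norm_nonneg _) (hB s) 2
  simp only [EuclideanSpace.norm_sq_eq, Real.norm_eq_abs, sq_abs] at h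
  rwa [Finset.sum_coe_sort s fun i => a i ^ 2] at h

/-! ### The decay estimate -/

theorem bddAbove_range_mul_exp {F : ℝ → ℝ} {σ t : ℝ} (hσ : 0 ≤ σ) (hF0 : ∀ s, 0 ≤ F s)
    (hF : BddAbove (F '' Ioo 0 t)) :
    BddAbove (range fun s : Ioo 0 t => F s * Real.exp (-σ * (t - s))) := by
  obtain ⟨M, hM⟩ := hF
  refine ⟨M, forall_mem_range.2 fun s => ?_⟩
  have hexp : Real.exp (-σ * (t - s)) ≤ 1 := by
    rw [Real.exp_le_one_iff, neg_mul, neg_nonpos]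
    exact mul_nonneg hσ (sub_pos.2 s.2.2).le
  exact (mul_le_of_le_one_right (hF0 s) hexp).trans (hM (mem_image_of_mem F s.2))

theorem le_iSup_mul_exp {F : ℝ → ℝ} {σ t : ℝ}
    (hF : BddAbove (range fun s : Ioo 0 t => F s * Real.exp (-σ * (t - s)))) :
    ∀ s ∈ Ioo 0 t,
      F s ≤ (⨆ s : Ioo 0 t, F s * Real.exp (-σ * (t - s))) * Real.exp (σ * (t - s)) := by
  intro s hs
  calc F s = F s * Real.exp (-σ * (t - s)) * Real.exp (σ * (t - s)) := by
        rw [mul_assoc, ← Real.exp_add, neg_mul, neg_add_cancel, Real.exp_zero, mul_one]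
    _ ≤ _ := mul_le_mul_of_nonneg_right (le_ciSup hF ⟨s, hs⟩) (Real.exp_pos _).le

theorem nonneg_of_forall_le_mul_exp {F : ℝ → ℝ} {σ t D : ℝ} (ht : 0 < t) (hF0 : ∀ s, 0 ≤ F s)
    (hF : ∀ s ∈ Ioo 0 t, F s ≤ D * Real.exp (σ * (t - s))) : 0 ≤ D :=
  nonneg_of_mul_nonneg_left ((hF0 _).trans (hF (t / 2) ⟨half_pos ht, half_lt_self ht⟩))
    (Real.exp_pos _)

namespace SLData.IsEigensystem

variable {S : SLData} {lam : ℕ → ℝ} {φ : ℕ → ℝ → ℝ}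

theorem lam_zero_le (hsys : S.IsEigensystem lam φ) (n : ℕ) : lam 0 ≤ lam n :=
  hsys.strictMono.monotone (Nat.zero_le n)

theorem norm_toLp_wInner_le (hsys : S.IsEigensystem lam φ) (h0 : ¬S.IsEigenvalue 0) {g : ℝ → ℝ}
    (hg : S.MemL2 g) (I : Finset ℕ) :
    ‖WithLp.toLp 2 fun i : I => S.wInner (φ i) g‖ ≤ S.norm g :=
  norm_toLp_le_of_hasSum_sq (hsys.hasSum_wInner_sq h0 hg) (norm_nonneg g) I

theorem norm_toLp_trace₀_mul_integral_le (hsys : S.IsEigensystem lam φ) {σ t D : ℝ} (hσ0 : 0 ≤ σ)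
    (hσ : σ < lam 0) (ht : 0 < t) {d : ℝ → ℝ}
    (hd : ∀ s ∈ Ioo 0 t, |d s| ≤ D * Real.exp (σ * (t - s))) (I : Finset ℕ) :
    ‖WithLp.toLp 2 fun i : I =>
      S.trace₀ (φ i) * ∫ s in (0 : ℝ)..t, Real.exp (-lam i * (t - s)) * d s‖ ≤
      lam 0 / (lam 0 - σ) * S.C₀ lam φ * D := by
  have h0 := hsys.not_isEigenvalue_zero (hσ0.trans_lt hσ)
  have hD : 0 ≤ D := nonneg_of_forall_le_mul_exp ht (fun s => abs_nonneg (d s)) hd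
  have hK : 0 ≤ lam 0 / (lam 0 - σ) := div_nonneg (hσ0.trans hσ.le) (sub_pos.2 hσ).le
  rw [mul_right_comm]
  exact (norm_toLp_mul_integral_exp_le (fun i : I => hsys.lam_zero_le i) hσ0 hσ
    ht.le hD hd).trans (mul_le_mul_of_nonneg_left (norm_toLp_le_of_hasSum_sq
      (hsys.hasSum_trace₀_sq h0) (C₀_nonneg S lam φ) I) (mul_nonneg hK hD))

theorem norm_toLp_trace₁_mul_integral_le (hsys : S.IsEigensystem lam φ) {σ t D : ℝ} (hσ0 : 0 ≤ σ)
    (hσ : σ < lam 0) (ht : 0 < t) {d : ℝ → ℝ}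
    (hd : ∀ s ∈ Ioo 0 t, |d s| ≤ D * Real.exp (σ * (t - s))) (I : Finset ℕ) :
    ‖WithLp.toLp 2 fun i : I =>
      S.trace₁ (φ i) * ∫ s in (0 : ℝ)..t, Real.exp (-lam i * (t - s)) * d s‖ ≤
      lam 0 / (lam 0 - σ) * S.C₁ lam φ * D := by
  have h0 := hsys.not_isEigenvalue_zero (hσ0.trans_lt hσ)
  have hD : 0 ≤ D := nonneg_of_forall_le_mul_exp ht (fun s => abs_nonneg (d s)) hd
  have hK : 0 ≤ lam 0 / (lam 0 - σ) := div_nonneg (hσ0.trans hσ.le) (sub_pos.2 hσ).le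
  rw [mul_right_comm]
  exact (norm_toLp_mul_integral_exp_le (fun i : I => hsys.lam_zero_le i) hσ0 hσ
    ht.le hD hd).trans (mul_le_mul_of_nonneg_left (norm_toLp_le_of_hasSum_sq
      (hsys.hasSum_trace₁_sq h0) (C₁_nonneg S lam φ) I) (mul_nonneg hK hD))

end SLData.IsEigensystem

namespace SLData.IsSolutionWith

variable {S : SLData} {τ : ℕ → ℝ} {f : ℝ → ℝ → ℝ} {u₀ d₀ d₁ : ℝ → ℝ} {u : ℝ → ℝ → ℝ}
  {lam : ℕ → ℝ} {φ : ℕ → ℝ → ℝ} {t : ℝ}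

theorem wInner_eq (hu : S.IsSolutionWith τ u₀ f d₀ d₁ u) (hτ : IsTimeSequence τ)
    (hsys : S.IsEigensystem lam φ) (n : ℕ) (ht : 0 ≤ t)
    (hf : IntervalIntegrable (fun s => S.wInner (φ n) (f s)) volume 0 t)
    (hd₀ : IntervalIntegrable d₀ volume 0 t) (hd₁ : IntervalIntegrable d₁ volume 0 t) :
    S.wInner (φ n) (u t) = Real.exp (-lam n * t) * S.wInner (φ n) u₀ +
      (∫ s in (0 : ℝ)..t, Real.exp (-lam n * (t - s)) * S.wInner (φ n) (f s)) +
      S.trace₀ (φ n) * (∫ s in (0 : ℝ)..t, Real.exp (-lam n * (t - s)) * d₀ s) +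
      S.trace₁ (φ n) * ∫ s in (0 : ℝ)..t, Real.exp (-lam n * (t - s)) * d₁ s := by
  have hderiv (s : ℝ) (hs : s ∈ Ioo 0 t \ range τ) :=
    have hreg : s ∈ regularTimes τ := ⟨hs.1.1.le, hs.2⟩
    hu.wInner_dt hτ hsys n hreg ▸
      hu.hasDerivAt_wInner hτ (hsys.contDiffOn n).continuousOn hreg
  have hexp : ContinuousOn (fun s => Real.exp (-lam n * (t - s))) (uIcc 0 t) := by fun_prop
  have hI {g : ℝ → ℝ} (hg : IntervalIntegrable g volume 0 t) :=
    hg.continuousOn_mul hexp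
  rw [← hu.wInner_initial, eq_exp_mul_add_integral ht (countable_range τ)
    ((hu.continuousOn_wInner (hsys.memL2 n)).mono Icc_subset_Ici_self) hderiv
    ((hf.add (hd₀.const_mul _)).add (hd₁.const_mul _))]
  simp only [mul_add, mul_left_comm _ (S.trace₀ (φ n)), mul_left_comm _ (S.trace₁ (φ n))]
  rw [intervalIntegral.integral_add ((hI hf).add ((hI hd₀).const_mul _)) ((hI hd₁).const_mul _),
    intervalIntegral.integral_add (hI hf) ((hI hd₀).const_mul _),
    intervalIntegral.integral_const_mul, intervalIntegral.integral_const_mul]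
  ring

theorem intervalIntegrable_wInner_input (hu : S.IsSolutionWith τ u₀ f d₀ d₁ u)
    (hτ : IsTimeSequence τ) (hsys : S.IsEigensystem lam φ) (n : ℕ) (ht : 0 ≤ t) {G : ℝ → ℝ}
    (hG : IntervalIntegrable G volume 0 t) (hf : ∀ s ∈ Ioo 0 t, S.norm (f s) ≤ G s) :
    IntervalIntegrable (fun s => S.wInner (φ n) (f s)) volume 0 t := by
  refine intervalIntegrable_of_abs_le ht (hu.aestronglyMeasurable_wInner_input hτ hsys n t) hG ?_
  filter_upwards [ae_mem_regularTimes τ t, ae_restrict_mem measurableSet_Ioo] with s hreg hs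
  have hwInner := abs_wInner_le (hsys.memL2 n) (hu.memL2_input hτ hreg)
  rw [hsys.normalized, one_mul] at hwInner
  exact hwInner.trans (hf s hs)

theorem intervalIntegrable_d₀ (hu : S.IsSolutionWith τ u₀ f d₀ d₁ u) (hτ : IsTimeSequence τ)
    (ht : 0 ≤ t) {G : ℝ → ℝ} (hG : IntervalIntegrable G volume 0 t)
    (hd₀ : ∀ s ∈ Ioo 0 t, |d₀ s| ≤ G s) : IntervalIntegrable d₀ volume 0 t :=
  intervalIntegrable_of_abs_le ht
    (hτ.aestronglyMeasurable_of_continuousOn (hu.continuousOn_d₀ hτ) t) hG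
    (ae_restrict_of_forall_mem measurableSet_Ioo hd₀)

theorem intervalIntegrable_d₁ (hu : S.IsSolutionWith τ u₀ f d₀ d₁ u) (hτ : IsTimeSequence τ)
    (ht : 0 ≤ t) {G : ℝ → ℝ} (hG : IntervalIntegrable G volume 0 t)
    (hd₁ : ∀ s ∈ Ioo 0 t, |d₁ s| ≤ G s) : IntervalIntegrable d₁ volume 0 t :=
  intervalIntegrable_of_abs_le ht
    (hτ.aestronglyMeasurable_of_continuousOn (hu.continuousOn_d₁ hτ) t) hG
    (ae_restrict_of_forall_mem measurableSet_Ioo hd₁)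

theorem norm_toLp_integral_wInner_input_le (hu : S.IsSolutionWith τ u₀ f d₀ d₁ u)
    (hτ : IsTimeSequence τ) (hsys : S.IsEigensystem lam φ) {σ F : ℝ} (hσ0 : 0 ≤ σ)
    (hσ : σ < lam 0) (ht : 0 < t) (hf : ∀ s ∈ Ioo 0 t, S.norm (f s) ≤ F * Real.exp (σ * (t - s)))
    (I : Finset ℕ) :
    ‖WithLp.toLp 2 fun i : I =>
      ∫ s in (0 : ℝ)..t, Real.exp (-lam i * (t - s)) * S.wInner (φ i) (f s)‖ ≤
      F / (lam 0 - σ) := by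
  have h0 := hsys.not_isEigenvalue_zero (hσ0.trans_lt hσ)
  have hF : 0 ≤ F := nonneg_of_forall_le_mul_exp ht (fun s => norm_nonneg (f s)) hf
  refine norm_toLp_integral_exp_mul_le (fun i : I => hsys.lam_zero_le i) hσ ht.le
    hF (fun i => hu.intervalIntegrable_wInner_input hτ hsys i ht.le
      (Continuous.intervalIntegrable (by fun_prop) _ _) hf) ?_
  filter_upwards [ae_mem_regularTimes τ t, ae_restrict_mem measurableSet_Ioo] with s hreg hs
  exact (hsys.norm_toLp_wInner_le h0 (hu.memL2_input hτ hreg) I).trans (hf s hs)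

theorem norm_le (hu : S.IsSolutionWith τ u₀ f d₀ d₁ u) (hτ : IsTimeSequence τ)
    (hsys : S.IsEigensystem lam φ) {σ D₀ D₁ F : ℝ} (hσ0 : 0 ≤ σ) (hσ : σ < lam 0) (ht : 0 < t)
    (hd₀ : ∀ s ∈ Ioo 0 t, |d₀ s| ≤ D₀ * Real.exp (σ * (t - s)))
    (hd₁ : ∀ s ∈ Ioo 0 t, |d₁ s| ≤ D₁ * Real.exp (σ * (t - s)))
    (hf : ∀ s ∈ Ioo 0 t, S.norm (f s) ≤ F * Real.exp (σ * (t - s))) :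
    S.norm (u t) ≤ Real.exp (-lam 0 * t) * S.norm u₀ + lam 0 / (lam 0 - σ) * S.C₀ lam φ * D₀ +
      lam 0 / (lam 0 - σ) * S.C₁ lam φ * D₁ + 1 / (lam 0 - σ) * F := by
  have h0 := hsys.not_isEigenvalue_zero (hσ0.trans_lt hσ)
  have hG (D : ℝ) : IntervalIntegrable (fun s => D * Real.exp (σ * (t - s))) volume 0 t :=
    Continuous.intervalIntegrable (by fun_prop) _ _
  refine le_of_hasSum_sq_of_forall_norm_toLp_le
    (hsys.hasSum_wInner_sq h0 (hu.memL2 t ht.le)) fun I => ?_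
  have hduhamel (n : ℕ) := hu.wInner_eq hτ hsys n ht.le
    (hu.intervalIntegrable_wInner_input hτ hsys n ht.le (hG F) hf)
    (hu.intervalIntegrable_d₀ hτ ht.le (hG D₀) hd₀) (hu.intervalIntegrable_d₁ hτ ht.le (hG D₁) hd₁)
  have hinitial : ‖WithLp.toLp 2 fun i : I => Real.exp (-lam i * t) * S.wInner (φ i) u₀‖ ≤
      Real.exp (-lam 0 * t) * S.norm u₀ :=
    (norm_toLp_exp_mul_le (fun i : I => hsys.lam_zero_le i) ht.le
      (WithLp.toLp 2 fun i : I => S.wInner (φ i) u₀)).trans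
      (mul_le_mul_of_nonneg_left (hsys.norm_toLp_wInner_le h0 hu.memL2_initial I)
        (Real.exp_pos _).le)
  have hinput := hu.norm_toLp_integral_wInner_input_le hτ hsys hσ0 hσ ht hf I
  have hboundary₀ := hsys.norm_toLp_trace₀_mul_integral_le hσ0 hσ ht hd₀ I
  have hboundary₁ := hsys.norm_toLp_trace₁_mul_integral_le hσ0 hσ ht hd₁ I
  simp only [hduhamel]
  refine (norm_add_le_of_le (norm_add_le_of_le (norm_add_le_of_le hinitial hinput) hboundary₀)
    hboundary₁).trans ?_
  rw [one_div_mul_eq_div]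
  linarith

end SLData.IsSolutionWith

theorem theorem2p4_general (S : SLData) (lam : ℕ → ℝ) (φ : ℕ → ℝ → ℝ)
    (hsys : S.IsEigensystem lam φ) (hES : 0 < lam 0) :
    Summable (S.gainTerm₀ lam φ) ∧ Summable (S.gainTerm₁ lam φ) ∧
    (∃ v : ℝ → ℝ, S.IsUniqueBVPSolution (Real.sqrt (S.b₁ ^ 2 + S.b₂ ^ 2)) 0 v ∧
      S.C₀ lam φ = 1 / Real.sqrt (S.b₁ ^ 2 + S.b₂ ^ 2) * S.norm v) ∧
    (∃ w : ℝ → ℝ, S.IsUniqueBVPSolution 0 (Real.sqrt (S.a₁ ^ 2 + S.a₂ ^ 2)) w ∧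
      S.C₁ lam φ = 1 / Real.sqrt (S.a₁ ^ 2 + S.a₂ ^ 2) * S.norm w) ∧
    ∀ (τ : ℕ → ℝ) (u₀ : ℝ → ℝ) (f : ℝ → ℝ → ℝ) (d₀ d₁ : ℝ → ℝ) (u : ℝ → ℝ → ℝ),
      IsTimeSequence τ → S.IsSolutionWith τ u₀ f d₀ d₁ u →
      ∀ σ ∈ Set.Ico 0 (lam 0), ∀ t : ℝ, 0 < t → BddAbove ((fun s => |d₀ s|) '' Ioo 0 t) →
        BddAbove ((fun s => |d₁ s|) '' Ioo 0 t) → BddAbove ((fun s => S.norm (f s)) '' Ioo 0 t) →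
        BddAbove (Set.range fun s : Set.Ioo 0 t => |d₀ s| * Real.exp (-σ * (t - s))) ∧
        BddAbove (Set.range fun s : Set.Ioo 0 t => |d₁ s| * Real.exp (-σ * (t - s))) ∧
        BddAbove (Set.range fun s : Set.Ioo 0 t => S.norm (f s) * Real.exp (-σ * (t - s))) ∧
        S.norm (u t) ≤ Real.exp (-lam 0 * t) * S.norm u₀
          + lam 0 / (lam 0 - σ) * S.C₀ lam φ *
              (⨆ s : Set.Ioo 0 t, |d₀ s| * Real.exp (-σ * (t - s)))
          + lam 0 / (lam 0 - σ) * S.C₁ lam φ *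
              (⨆ s : Set.Ioo 0 t, |d₁ s| * Real.exp (-σ * (t - s)))
          + 1 / (lam 0 - σ) *
              (⨆ s : Set.Ioo 0 t, S.norm (f s) * Real.exp (-σ * (t - s))) := by
  have h0 := hsys.not_isEigenvalue_zero hES
  obtain ⟨v, hv⟩ := SLData.exists_isUniqueBVPSolution h0 (Real.sqrt (S.b₁ ^ 2 + S.b₂ ^ 2)) 0
  obtain ⟨w, hw⟩ := SLData.exists_isUniqueBVPSolution h0 0 (Real.sqrt (S.a₁ ^ 2 + S.a₂ ^ 2))
  refine ⟨hsys.summable_gainTerm₀ h0, hsys.summable_gainTerm₁ h0,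
    ⟨v, hv, hsys.C₀_eq h0 (Real.sqrt_pos.2 S.b_sq_pos) hv.1⟩,
    ⟨w, hw, hsys.C₁_eq h0 (Real.sqrt_pos.2 S.a_sq_pos) hw.1⟩, ?_⟩
  intro τ u₀ f d₀ d₁ u hτ hu σ ⟨hσ0, hσ⟩ t ht hd₀ hd₁ hf
  have hb₀ := bddAbove_range_mul_exp hσ0 (fun s => abs_nonneg (d₀ s)) hd₀
  have hb₁ := bddAbove_range_mul_exp hσ0 (fun s => abs_nonneg (d₁ s)) hd₁
  have hbf := bddAbove_range_mul_exp hσ0 (fun s => SLData.norm_nonneg (S := S) (f s)) hf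
  exact ⟨hb₀, hb₁, hbf, hu.norm_le hτ hsys hσ0 hσ ht (le_iSup_mul_exp hb₀) (le_iSup_mul_exp hb₁)
    (le_iSup_mul_exp hbf)⟩

theorem theorem2p4 (S : SLData) (lam : ℕ → ℝ) (φ : ℕ → ℝ → ℝ)
    (hsys : S.IsEigensystem lam φ) (hH : AssumptionH lam φ) (hES : 0 < lam 0) :
    -- the gains: convergence of the series, and the representation by stationary problems
    Summable (S.gainTerm₀ lam φ) ∧ Summable (S.gainTerm₁ lam φ) ∧
    (∃ v : ℝ → ℝ, S.IsUniqueBVPSolution (Real.sqrt (S.b₁ ^ 2 + S.b₂ ^ 2)) 0 v ∧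
      S.C₀ lam φ = 1 / Real.sqrt (S.b₁ ^ 2 + S.b₂ ^ 2) * S.norm v) ∧
    (∃ w : ℝ → ℝ, S.IsUniqueBVPSolution 0 (Real.sqrt (S.a₁ ^ 2 + S.a₂ ^ 2)) w ∧
      S.C₁ lam φ = 1 / Real.sqrt (S.a₁ ^ 2 + S.a₂ ^ 2) * S.norm w) ∧
    -- the estimate, whose suprema are finite
    ∀ (u₀ : ℝ → ℝ) (f : ℝ → ℝ → ℝ) (d₀ d₁ : ℝ → ℝ) (u : ℝ → ℝ → ℝ),
      S.MemL2 u₀ → S.IsGD f → IsGB d₀ → IsGB d₁ → S.IsSolution u₀ f d₀ d₁ u →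
      ∀ σ ∈ Set.Ico 0 (lam 0), ∀ t : ℝ, 0 < t →
        BddAbove (Set.range fun s : Set.Ioo 0 t => |d₀ s| * Real.exp (-σ * (t - s))) ∧
        BddAbove (Set.range fun s : Set.Ioo 0 t => |d₁ s| * Real.exp (-σ * (t - s))) ∧
        BddAbove (Set.range fun s : Set.Ioo 0 t => S.norm (f s) * Real.exp (-σ * (t - s))) ∧
        S.norm (u t) ≤ Real.exp (-lam 0 * t) * S.norm u₀
          + lam 0 / (lam 0 - σ) * S.C₀ lam φ *
              (⨆ s : Set.Ioo 0 t, |d₀ s| * Real.exp (-σ * (t - s)))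
          + lam 0 / (lam 0 - σ) * S.C₁ lam φ *
              (⨆ s : Set.Ioo 0 t, |d₁ s| * Real.exp (-σ * (t - s)))
          + 1 / (lam 0 - σ) *
              (⨆ s : Set.Ioo 0 t, S.norm (f s) * Real.exp (-σ * (t - s))) := by
  obtain ⟨hs₀, hs₁, hv, hw, hest⟩ := theorem2p4_general S lam φ hsys hES
  refine ⟨hs₀, hs₁, hv, hw, ?_⟩
  rintro u₀ f d₀ d₁ u - - - - ⟨τ, hτ, hf, hd₀, hd₁, hu⟩ σ hσ t ht
  exact hest τ u₀ f d₀ d₁ u hτ hu σ hσ t ht (hd₀.bddAbove_image_abs hτ t)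
    (hd₁.bddAbove_image_abs hτ t) (hf.bddAbove_image_norm hτ t)
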